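/- **Setting.** Two-sorted arithmetic has number variables $x,y,\dots$ and string variables $X,Y,\dots$ (strings are finite subsets of $\mathbb N$; $X(i)$ means $i\in X$; $|X|=1+\max X$ and $|\emptyset|=0$), over the vocabulary $\mathcal L_A^2=[0,1,+,\cdot,|\ |;=_1,=_2,\le,\in]$. A $\Sigma_0^B$ formula has only bounded number quantifiers and no string quantifiers; a $\Sigma_1^B(\mathcal L^2_A)$ formula is $\exists X_1\le t_1\cdots\exists X_l\le t_l\,\psi$ with $\psi$ a $\Sigma_0^B$ formula and no $X_i$ occurring in any $t_j$ (here $\exists X\le t\,\psi$ means $\exists X(|X|\le t\wedge\psi)$). The pairing function is $\langle x,y\rangle=(x+y)(x+y+1)+2y$, and $X(x,y)$ stands for $X(\langle x,y\rangle)$. The string $X^{[x]}$ has bits $X^{[x]}(i)\leftrightarrow i<|X|\wedge X(x,i)$; the number $(X)^x$ is the least $y<|X|$ with $X(x,y)$, or $|X|$ if there is none. A string $X$ encodes the $n\times n$ matrix over $\mathbb Z_2$ whose $(i,j)$ entry ($i,j<n$) is $1$ iff $X(i,j)$. **Functions.** $\mathrm{PowSeq}_2(n,k,X)$ is the string encoding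 the list $[I_n,X,X^2,\dots,X^k]$ of powers of this matrix: its bit $\langle i,\langle r,c\rangle\rangle$, for $i\le k$ and $r,c<n$, is the $(r,c)$ entry of $X^i$, and all its other bits are $0$. The aggregate function $\mathrm{PowSeq}_2^\star(b,W_1,W_2,X)$ is the string with $$\mathrm{PowSeq}_2^\star(b,W_1,W_2,X)(i,v)\leftrightarrow i<b\wedge \mathrm{PowSeq}_2\big((W_1)^i,(W_2)^i,X^{[i]}\big)(v),$$ all of whose bits at positions that are not of the form $\langle i,v\rangle$ are $0$. **Theories.** $V^0$ is axiomatized by 2-BASIC and the comprehension scheme $\exists X\le y\,\forall z<y\,(X(z)\leftrightarrow\varphi(z))$ for $\Sigma_0^B$ formulas $\varphi$ not containing $X$. $V^0(2)$ is $V^0$ with the axiom $\exists Y\le x+1\,\big(\neg Y(0)\wedge\forall z<x\,(Y(z+1)\leftrightarrow (X(z)\oplus Y(z)))\big)$. $V{\oplus}L$ is $V^0(2)$ with the $\Sigma_1^B(\mathcal L_A^2)$ axiom $PS_2$ asserting that $\mathrm{PowSeq}_2(n,k,X)$ exists: $$\exists Y\le\langle k,\langle n,n\rangle\rangle\ \exists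 Z\le\langle k,\langle\langle n,n\rangle,n\rangle\rangle\ \alpha(n,k,X,Y,Z),$$ where $\alpha$ is the conjunction of - $\forall b<|Y|\,\big(Y(b)\supset\exists i\le k\,\exists r,c<n\ b=\langle i,\langle r,c\rangle\rangle\big)$; - $\forall r,c<n\,\big(Y(\langle 0,\langle r,c\rangle\rangle)\leftrightarrow r=c\big)$; - for all $i<k$ and $r,c<n$, writing $P$ for $Z^{[i][\langle r,c\rangle]}$, that is, $P(l)$ for $Z(\langle i,\langle\langle r,c\rangle,l\rangle\rangle)$: $\neg P(0)$; $\forall l<n\,\big(P(l+1)\leftrightarrow (P(l)\oplus(X(r,l)\wedge Y(\langle i,\langle l,c\rangle\rangle)))\big)$; and $Y(\langle i+1,\langle r,c\rangle\rangle)\leftrightarrow P(n)$. **Lemma.** The aggregate matrix powering function $\mathrm{PowSeq}_2^\star$ is $\Sigma_1^B(\mathcal L_A^2)$-definable in $V{\oplus}L$. That is, there is a $\Sigma_1^B(\mathcal L_A^2)$ formula $\varphi(b,W_1,W_2,X,Y)$ such that $$V{\oplus}L\vdash\forall b\,\forall W_1,W_2,X\,\exists!Y\,\varphi(b,W_1,W_2,X,Y)$$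 and, in the standard model, $Y=\mathrm{PowSeq}_2^\star(b,W_1,W_2,X)\leftrightarrow\varphi(b,W_1,W_2,X,Y)$ for all $b,W_1,W_2,X,Y$. (A theory is the set of logical consequences of its axioms, and $T\vdash\varphi$ means that the universal closure of $\varphi$ belongs to it.) -/

import Mathlib

universe u v

namespace TwoSorted

/-! ## Syntax of two-sorted arithmetic -/

/-- Number terms of the vocabulary `0, 1, +, ·, | | ; =₁, =₂, ≤, ∈` with `n` number variables and
`m` string variables. The only string terms of the vocabulary are string variables. -/
inductive NumTerm (n m : ℕ) : Type
  | var (i : Fin n) : NumTerm n m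
  | zero : NumTerm n m
  | one : NumTerm n m
  | add (s t : NumTerm n m) : NumTerm n m
  | mul (s t : NumTerm n m) : NumTerm n m
  | len (X : Fin m) : NumTerm n m

namespace NumTerm

instance {n m : ℕ} : Zero (NumTerm n m) := ⟨zero⟩
instance {n m : ℕ} : One (NumTerm n m) := ⟨one⟩
instance {n m : ℕ} : Add (NumTerm n m) := ⟨add⟩
instance {n m : ℕ} : Mul (NumTerm n m) := ⟨mul⟩

/-- Renaming of the variables of a term. -/
def rename {n m n' m' : ℕ} (f : Fin n → Fin n') (g : Fin m → Fin m') :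
    NumTerm n m → NumTerm n' m'
  | var i => var (f i)
  | zero => zero
  | one => one
  | add s t => add (s.rename f g) (t.rename f g)
  | mul s t => mul (s.rename f g) (t.rename f g)
  | len X => len (g X)

/-- The pairing term `⟨s, t⟩ = (s + t)(s + t + 1) + 2t`. -/
def pair {n m : ℕ} (s t : NumTerm n m) : NumTerm n m :=
  (s + t) * (s + t + 1) + (1 + 1) * t

end NumTerm

/-- Formulas with free number variables indexed by `Fin n` and free string variables indexed by
`Fin m`. A quantifier binds the variable with index `0` of its sort, and the other variables of
that sort are shifted up by one. -/
inductive Fml : ℕ → ℕ → Type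
  | verum {n m : ℕ} : Fml n m
  | falsum {n m : ℕ} : Fml n m
  | eqNum {n m : ℕ} (s t : NumTerm n m) : Fml n m
  | eqStr {n m : ℕ} (X Y : Fin m) : Fml n m
  | le {n m : ℕ} (s t : NumTerm n m) : Fml n m
  | mem {n m : ℕ} (t : NumTerm n m) (X : Fin m) : Fml n m
  | not {n m : ℕ} (φ : Fml n m) : Fml n m
  | and {n m : ℕ} (φ ψ : Fml n m) : Fml n m
  | or {n m : ℕ} (φ ψ : Fml n m) : Fml n m
  | exNum {n m : ℕ} (φ : Fml (n + 1) m) : Fml n m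
  | allNum {n m : ℕ} (φ : Fml (n + 1) m) : Fml n m
  | exStr {n m : ℕ} (φ : Fml n (m + 1)) : Fml n m
  | allStr {n m : ℕ} (φ : Fml n (m + 1)) : Fml n m

/-- Extension of a renaming under a quantifier: the bound variable `0` is kept. -/
def liftRen {n n' : ℕ} (f : Fin n → Fin n') : Fin (n + 1) → Fin (n' + 1) :=
  Matrix.vecCons 0 (fun i => (f i).succ)

namespace Fml

/-- Renaming of the free variables of a formula. -/
def rename : {n m n' m' : ℕ} → (Fin n → Fin n') → (Fin m → Fin m') → Fml n m → Fml n' m'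
  | _, _, _, _, _, _, verum => verum
  | _, _, _, _, _, _, falsum => falsum
  | _, _, _, _, f, g, eqNum s t => eqNum (s.rename f g) (t.rename f g)
  | _, _, _, _, _, g, eqStr X Y => eqStr (g X) (g Y)
  | _, _, _, _, f, g, le s t => le (s.rename f g) (t.rename f g)
  | _, _, _, _, f, g, mem t X => mem (t.rename f g) (g X)
  | _, _, _, _, f, g, not φ => not (φ.rename f g)
  | _, _, _, _, f, g, and φ ψ => and (φ.rename f g) (ψ.rename f g)
  | _, _, _, _, f, g, or φ ψ => or (φ.rename f g) (ψ.rename f g)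
  | _, _, _, _, f, g, exNum φ => exNum (φ.rename (liftRen f) g)
  | _, _, _, _, f, g, allNum φ => allNum (φ.rename (liftRen f) g)
  | _, _, _, _, f, g, exStr φ => exStr (φ.rename f (liftRen g))
  | _, _, _, _, f, g, allStr φ => allStr (φ.rename f (liftRen g))

def imp {n m : ℕ} (φ ψ : Fml n m) : Fml n m := or (not φ) ψ

def iff {n m : ℕ} (φ ψ : Fml n m) : Fml n m := and (imp φ ψ) (imp ψ φ)

/-- Exclusive or. -/
def xor {n m : ℕ} (φ ψ : Fml n m) : Fml n m := or (and φ (not ψ)) (and (not φ) ψ)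

/-- `s < t` abbreviates `s ≤ t ∧ s ≠ t`. -/
def lt {n m : ℕ} (s t : NumTerm n m) : Fml n m := and (le s t) (not (eqNum s t))

/-- `∃ x ≤ t, φ`; the bound `t` does not contain `x`. -/
def exLe {n m : ℕ} (t : NumTerm n m) (φ : Fml (n + 1) m) : Fml n m :=
  exNum (and (le (.var 0) (t.rename Fin.succ id)) φ)

/-- `∀ x ≤ t, φ`; the bound `t` does not contain `x`. -/
def allLe {n m : ℕ} (t : NumTerm n m) (φ : Fml (n + 1) m) : Fml n m :=
  allNum (imp (le (.var 0) (t.rename Fin.succ id)) φ)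

/-- `∃ x < t, φ`. -/
def exLt {n m : ℕ} (t : NumTerm n m) (φ : Fml (n + 1) m) : Fml n m :=
  exLe t (and (lt (.var 0) (t.rename Fin.succ id)) φ)

/-- `∀ x < t, φ`. -/
def allLt {n m : ℕ} (t : NumTerm n m) (φ : Fml (n + 1) m) : Fml n m :=
  allLe t (imp (lt (.var 0) (t.rename Fin.succ id)) φ)

/-- `∃ X ≤ t, φ`, that is `∃ X (|X| ≤ t ∧ φ)`; the bound `t` does not contain `X`. -/
def exStrLe {n m : ℕ} (t : NumTerm n m) (φ : Fml n (m + 1)) : Fml n m :=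
  exStr (and (le (.len 0) (t.rename id Fin.succ)) φ)

/-- `∃! Y, φ(Y)`, that is `∃ Y (φ(Y) ∧ ∀ Y' (φ(Y') ⊃ Y = Y'))`. -/
def exUniqueStr {n m : ℕ} (φ : Fml n (m + 1)) : Fml n m :=
  exStr (and φ (allStr (imp (φ.rename id (Matrix.vecCons 0 (fun i => i.succ.succ))) (eqStr 1 0))))

end Fml

/-- `Σ₀ᴮ` formulas: every number quantifier is bounded, and there is no string quantifier
(free string variables are allowed). -/
inductive IsSigmaB0 : {n m : ℕ} → Fml n m → Prop
  | verum {n m : ℕ} : IsSigmaB0 (Fml.verum : Fml n m)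
  | falsum {n m : ℕ} : IsSigmaB0 (Fml.falsum : Fml n m)
  | eqNum {n m : ℕ} (s t : NumTerm n m) : IsSigmaB0 (Fml.eqNum s t)
  | eqStr {n m : ℕ} (X Y : Fin m) : IsSigmaB0 (Fml.eqStr X Y : Fml n m)
  | le {n m : ℕ} (s t : NumTerm n m) : IsSigmaB0 (Fml.le s t)
  | mem {n m : ℕ} (t : NumTerm n m) (X : Fin m) : IsSigmaB0 (Fml.mem t X)
  | not {n m : ℕ} {φ : Fml n m} : IsSigmaB0 φ → IsSigmaB0 (Fml.not φ)
  | and {n m : ℕ} {φ ψ : Fml n m} : IsSigmaB0 φ → IsSigmaB0 ψ → IsSigmaB0 (Fml.and φ ψ)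
  | or {n m : ℕ} {φ ψ : Fml n m} : IsSigmaB0 φ → IsSigmaB0 ψ → IsSigmaB0 (Fml.or φ ψ)
  | exLe {n m : ℕ} (t : NumTerm n m) {φ : Fml (n + 1) m} :
      IsSigmaB0 φ → IsSigmaB0 (Fml.exLe t φ)
  | allLe {n m : ℕ} (t : NumTerm n m) {φ : Fml (n + 1) m} :
      IsSigmaB0 φ → IsSigmaB0 (Fml.allLe t φ)

/-- `∃ X₁ ≤ t₁ … ∃ X_k ≤ t_k, ψ` with `ψ` a `Σ₀ᴮ` formula (`k ≥ 0`). The renaming `g` records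
where the `m₀` string variables that are free outside the block are found; the bounds `t_j` are
terms in these, so that no `X_i` occurs in any `t_j`. -/
inductive IsSigmaB1Block {n m₀ : ℕ} : {m : ℕ} → (Fin m₀ → Fin m) → Fml n m → Prop
  | matrix {m : ℕ} {g : Fin m₀ → Fin m} {ψ : Fml n m} : IsSigmaB0 ψ → IsSigmaB1Block g ψ
  | exStrLe {m : ℕ} {g : Fin m₀ → Fin m} (t : NumTerm n m₀) {φ : Fml n (m + 1)} :
      IsSigmaB1Block (fun i => (g i).succ) φ → IsSigmaB1Block g (Fml.exStrLe (t.rename id g) φ)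

/-- `Σ₁ᴮ` formulas. -/
def IsSigmaB1 {n m : ℕ} (φ : Fml n m) : Prop := IsSigmaB1Block id φ

/-! ## Structures, truth and logical consequence -/

/-- Two-sorted structures for the vocabulary; both sorts are nonempty (`zero` is a number), and
the two equality symbols are interpreted as equality. -/
structure Struct : Type (max (u + 1) (v + 1)) where
  Num : Type u
  Str : Type v
  str_nonempty : Nonempty Str
  zero : Num
  one : Num
  add : Num → Num → Num
  mul : Num → Num → Num
  len : Str → Num
  le : Num → Num → Prop
  mem : Num → Str → Prop

/-- Value of a number term under an assignment. -/
def NumTerm.val (M : Struct.{u, v}) {n m : ℕ} (e : Fin n → M.Num) (E : Fin m → M.Str) :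
    NumTerm n m → M.Num
  | .var i => e i
  | .zero => M.zero
  | .one => M.one
  | .add s t => M.add (s.val M e E) (t.val M e E)
  | .mul s t => M.mul (s.val M e E) (t.val M e E)
  | .len X => M.len (E X)

/-- Truth of a formula in a structure under an assignment. -/
def Fml.Holds (M : Struct.{u, v}) :
    {n m : ℕ} → Fml n m → (Fin n → M.Num) → (Fin m → M.Str) → Prop
  | _, _, .verum, _, _ => True
  | _, _, .falsum, _, _ => False
  | _, _, .eqNum s t, e, E => s.val M e E = t.val M e E
  | _, _, .eqStr X Y, _, E => E X = E Y
  | _, _, .le s t, e, E => M.le (s.val M e E) (t.val M e E)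
  | _, _, .mem t X, e, E => M.mem (t.val M e E) (E X)
  | _, _, .not φ, e, E => ¬ φ.Holds M e E
  | _, _, .and φ ψ, e, E => φ.Holds M e E ∧ ψ.Holds M e E
  | _, _, .or φ ψ, e, E => φ.Holds M e E ∨ ψ.Holds M e E
  | _, _, .exNum φ, e, E => ∃ a : M.Num, φ.Holds M (Matrix.vecCons a e) E
  | _, _, .allNum φ, e, E => ∀ a : M.Num, φ.Holds M (Matrix.vecCons a e) E
  | _, _, .exStr φ, e, E => ∃ A : M.Str, φ.Holds M e (Matrix.vecCons A E)
  | _, _, .allStr φ, e, E => ∀ A : M.Str, φ.Holds M e (Matrix.vecCons A E)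

/-- A set of axioms; free variables of an axiom are read as universally quantified. -/
abbrev AxiomSet : Type := ∀ ⦃n m : ℕ⦄, Fml n m → Prop

/-- `M` is a model of (the universal closures of) the axioms `T`. -/
def Struct.IsModel (M : Struct.{u, v}) (T : AxiomSet) : Prop :=
  ∀ ⦃n m : ℕ⦄ (φ : Fml n m), T φ → ∀ e E, φ.Holds M e E

/-- The theory axiomatized by `T` is the set of logical consequences of `T`, and `T ⊢ φ` means that
the universal closure of `φ` belongs to it. -/
def Proves (T : AxiomSet) {n m : ℕ} (φ : Fml n m) : Prop :=
  ∀ M : Struct.{u, v}, M.IsModel T → ∀ e E, φ.Holds M e E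

/-- The length of a finite set of natural numbers, read as a bit string:
`|X| = 1 + max X`, and `|∅| = 0`. -/
def strLen (X : Finset ℕ) : ℕ := X.sup (fun i => i + 1)

/-- The standard model: natural numbers and finite sets of natural numbers. -/
def standardModel : Struct.{0, 0} where
  Num := ℕ
  Str := Finset ℕ
  str_nonempty := ⟨∅⟩
  zero := 0
  one := 1
  add := fun x y => x + y
  mul := fun x y => x * y
  len := strLen
  le := fun x y => x ≤ y
  mem := fun i X => i ∈ X

/-! ## The theories `V⁰ ⊆ V⁰(2) ⊆ V⊕L` -/

open Fml NumTerm in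
/-- The axioms 2-BASIC. -/
inductive TwoBasic : ∀ ⦃n m : ℕ⦄, Fml n m → Prop
  -- x + 1 ≠ 0
  | B1 : TwoBasic (not (eqNum (var 0 + 1) 0) : Fml 1 0)
  -- x + 1 = y + 1 ⊃ x = y
  | B2 : TwoBasic (imp (eqNum (var 0 + 1) (var 1 + 1)) (eqNum (var 0) (var 1)) : Fml 2 0)
  -- x + 0 = x
  | B3 : TwoBasic (eqNum (var 0 + 0) (var 0) : Fml 1 0)
  -- x + (y + 1) = (x + y) + 1
  | B4 : TwoBasic (eqNum (var 0 + (var 1 + 1)) ((var 0 + var 1) + 1) : Fml 2 0)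
  -- x · 0 = 0
  | B5 : TwoBasic (eqNum (var 0 * 0) 0 : Fml 1 0)
  -- x · (y + 1) = x · y + x
  | B6 : TwoBasic (eqNum (var 0 * (var 1 + 1)) (var 0 * var 1 + var 0) : Fml 2 0)
  -- (x ≤ y ∧ y ≤ x) ⊃ x = y
  | B7 : TwoBasic
      (imp (and (le (var 0) (var 1)) (le (var 1) (var 0))) (eqNum (var 0) (var 1)) : Fml 2 0)
  -- x ≤ x + y
  | B8 : TwoBasic (le (var 0) (var 0 + var 1) : Fml 2 0)
  -- 0 ≤ x
  | B9 : TwoBasic (le 0 (var 0) : Fml 1 0)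
  -- x ≤ y ∨ y ≤ x
  | B10 : TwoBasic (or (le (var 0) (var 1)) (le (var 1) (var 0)) : Fml 2 0)
  -- x ≤ y ↔ x < y + 1
  | B11 : TwoBasic (iff (le (var 0) (var 1)) (lt (var 0) (var 1 + 1)) : Fml 2 0)
  -- x ≠ 0 ⊃ ∃ y ≤ x, y + 1 = x
  | B12 : TwoBasic
      (imp (not (eqNum (var 0) 0)) (exLe (var 0) (eqNum (var 0 + 1) (var 1))) : Fml 1 0)
  -- X(y) ⊃ y < |X|
  | L1 : TwoBasic (imp (mem (var 0) 0) (lt (var 0) (len 0)) : Fml 1 1)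
  -- y + 1 = |X| ⊃ X(y)
  | L2 : TwoBasic (imp (eqNum (var 0 + 1) (len 0)) (mem (var 0) 0) : Fml 1 1)
  -- (|X| = |Y| ∧ ∀ i < |X|, (X(i) ↔ Y(i))) ⊃ X = Y
  | SE : TwoBasic
      (imp (and (eqNum (len 0) (len 1)) (allLt (len 0) (iff (mem (var 0) 0) (mem (var 0) 1))))
        (eqStr 0 1) : Fml 0 2)

/-- The comprehension axiom `∃ X ≤ y, ∀ z < y, (X(z) ↔ φ(z))`. In `φ` the variable `z` has
index `0`; the new string variable `X` does not occur in `φ`, all other variables may. -/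
def compAxiom {n m : ℕ} (y : Fin n) (φ : Fml (n + 1) m) : Fml n m :=
  Fml.exStrLe (.var y)
    (Fml.allLt (.var y) (Fml.iff (Fml.mem (.var 0) 0) (φ.rename id Fin.succ)))

/-- `V⁰`: the axioms 2-BASIC and comprehension for `Σ₀ᴮ` formulas. -/
inductive V0 : ∀ ⦃n m : ℕ⦄, Fml n m → Prop
  | basic {n m : ℕ} {φ : Fml n m} : TwoBasic φ → V0 φ
  | comp {n m : ℕ} (y : Fin n) {φ : Fml (n + 1) m} : IsSigmaB0 φ → V0 (compAxiom y φ)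

open Fml NumTerm in
/-- The axiom `∃ Y ≤ x + 1, (¬Y(0) ∧ ∀ z < x, (Y(z + 1) ↔ (X(z) ⊕ Y(z))))`: bit `z` of `Y` is the
parity of the number of elements of `X` below `z`. Variables: `x` is number variable `0`, `X` is
string variable `0`, which becomes `1` under the quantifier of `Y`. -/
def parityAxiom : Fml 1 1 :=
  exStrLe (var 0 + 1)
    (and (not (mem 0 0))
      (allLt (var 0)
        (iff (mem (var 0 + 1) 0) (xor (mem (var 0) 1) (mem (var 0) 0)))))

/-- `V⁰(2)`. -/
inductive V0Two : ∀ ⦃n m : ℕ⦄, Fml n m → Prop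
  | base {n m : ℕ} {φ : Fml n m} : V0 φ → V0Two φ
  | parity : V0Two parityAxiom

open Fml NumTerm in
/-- The `Σ₀ᴮ` formula stating that `Y` is the list `[ID(n), X, X², …, X^k]` of `n × n` matrices over
`ℤ/2`, as witnessed by `Z`; every bit of `Y` that does not encode an entry of one of these matrices
is zero. Free variables: numbers `n = 0`, `k = 1`; strings `Z = 0`, `Y = 1`, `X = 2`.

For `i < k` and `r, c < n` the string `Z^{[i][⟨r,c⟩]}` lists the partial sums modulo 2 of
`∑_{l < n} X(r,l) · Y^{[i]}(l,c)`, so that its bit `n` is entry `(r,c)` of the product of `X` and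
`Y^{[i]}`. -/
def powSeqWitness : Fml 2 3 :=
  and
    -- ∀ b < |Y|, (Y(b) ⊃ ∃ i ≤ k, ∃ r < n, ∃ c < n, b = ⟨i, ⟨r, c⟩⟩)
    (allLt (len 1)
      (imp (mem (var 0) 1)
        (exLe (var 2) (exLt (var 2) (exLt (var 3)
          (eqNum (var 3) (pair (var 2) (pair (var 1) (var 0)))))))))
  (and
    -- ∀ r < n, ∀ c < n, (Y(0, ⟨r, c⟩) ↔ r = c)
    (allLt (var 0) (allLt (var 1)
      (iff (mem (pair 0 (pair (var 1) (var 0))) 1) (eqNum (var 1) (var 0)))))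
    -- ∀ i < k, ∀ r < n, ∀ c < n,
    (allLt (var 1) (allLt (var 1) (allLt (var 2)
      (and
        -- ¬Z(i, ⟨⟨r, c⟩, 0⟩)
        (not (mem (pair (var 2) (pair (pair (var 1) (var 0)) 0)) 0))
      (and
        -- ∀ l < n, Z(i, ⟨⟨r, c⟩, l + 1⟩) ↔ (Z(i, ⟨⟨r, c⟩, l⟩) ⊕ (X(r, l) ∧ Y(i, ⟨l, c⟩)))
        (allLt (var 3)
          (iff (mem (pair (var 3) (pair (pair (var 2) (var 1)) (var 0 + 1))) 0)
            (xor (mem (pair (var 3) (pair (pair (var 2) (var 1)) (var 0))) 0)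
              (and (mem (pair (var 2) (var 0)) 2)
                (mem (pair (var 3) (pair (var 0) (var 1))) 1)))))
        -- Y(i + 1, ⟨r, c⟩) ↔ Z(i, ⟨⟨r, c⟩, n⟩)
        (iff (mem (pair (var 2 + 1) (pair (var 1) (var 0))) 1)
          (mem (pair (var 2) (pair (pair (var 1) (var 0)) (var 3))) 0))))))))

open Fml NumTerm in
/-- The axiom `PS₂`: `∃ Y ≤ ⟨k, ⟨n, n⟩⟩, ∃ Z ≤ ⟨k, ⟨⟨n, n⟩, n⟩⟩, powSeqWitness(n, k, X, Y, Z)`. Free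
variables: numbers `n = 0`, `k = 1`; string `X = 0`. -/
def powSeqAxiom : Fml 2 1 :=
  exStrLe (pair (var 1) (pair (var 0) (var 0)))
    (exStrLe (pair (var 1) (pair (pair (var 0) (var 0)) (var 0))) powSeqWitness)

/-- `V⊕L`: the axioms of `V⁰(2)` and the axiom `PS₂`. -/
inductive VParityL : ∀ ⦃n m : ℕ⦄, Fml n m → Prop
  | base {n m : ℕ} {φ : Fml n m} : V0Two φ → VParityL φ
  | powSeq : VParityL powSeqAxiom

/-! ## Definability of string functions in a theory -/

/-- A string function with `a` number and `c` string arguments is `Σ₁ᴮ`-definable in the theory `T`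
if some `Σ₁ᴮ` formula `φ(x⃗, X⃗, Y)` represents its graph (in the standard model) and
`T ⊢ ∀ x⃗ ∀ X⃗ ∃! Y, φ(x⃗, X⃗, Y)`. In `φ` the string variable `Y` has index `0`. -/
def SigmaB1Definable (T : AxiomSet) {a c : ℕ}
    (F : (Fin a → ℕ) → (Fin c → Finset ℕ) → Finset ℕ) : Prop :=
  ∃ φ : Fml a (c + 1), IsSigmaB1 φ ∧
    Proves.{u, v} T φ.exUniqueStr ∧
    ∀ (x : Fin a → ℕ) (X : Fin c → Finset ℕ) (Y : Finset ℕ),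
      Y = F x X ↔ φ.Holds standardModel x (Matrix.vecCons Y X)

/-! ## The aggregate matrix powering function -/

/-- The pairing function `⟨x, y⟩ = (x + y)(x + y + 1) + 2y`. -/
def natPair (x y : ℕ) : ℕ := (x + y) * (x + y + 1) + 2 * y

/-- `Row(x, Z) = Z^{[x]}`. -/
def row (x : ℕ) (Z : Finset ℕ) : Finset ℕ :=
  (Finset.range (strLen Z)).filter (fun i => natPair x i ∈ Z)

/-- `seq(x, Z) = (Z)^x`: the least element of row `x` of `Z`, and `|Z|` if that row is empty. -/
def seq (x : ℕ) (Z : Finset ℕ) : ℕ :=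
  if h : ∃ y, y < strLen Z ∧ natPair x y ∈ Z then Nat.find h else strLen Z

/-- The `n × n` matrix over `ℤ/2` encoded by a string. -/
def strMatrix (n : ℕ) (X : Finset ℕ) : Matrix (Fin n) (Fin n) (ZMod 2) :=
  fun i j => if natPair i j ∈ X then 1 else 0

/-- `PowSeq₂(n, k, X)`: the string that encodes the list of matrices `[ID(n), X, X², …, X^k]`; the bit
`⟨i, ⟨r, c⟩⟩` (for `i ≤ k` and `r, c < n`) is entry `(r, c)` of `X^i`, all other bits are zero. -/
def powSeq (n k : ℕ) (X : Finset ℕ) : Finset ℕ :=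
  ((Finset.range (k + 1) ×ˢ (Finset.univ : Finset (Fin n × Fin n))).filter
      (fun p => (strMatrix n X ^ p.1) p.2.1 p.2.2 = 1)).image
    (fun p => natPair p.1 (natPair p.2.1 p.2.2))

/-- `PowSeq₂*(b, W₁, W₂, X)`: the bit `⟨i, v⟩` is one if and only if `i < b` and bit `v` of
`PowSeq₂((W₁)^i, (W₂)^i, X^{[i]})` is one; all other bits are zero. -/
def powSeqStar (b : ℕ) (W₁ W₂ X : Finset ℕ) : Finset ℕ :=
  (Finset.range b).biUnion (fun i =>
    (powSeq (seq i W₁) (seq i W₂) (row i X)).image (fun v => natPair i v))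

end TwoSorted

/-!
The aggregate function needs the powers of `b` matrices at once, while the axiom `PS₂` yields the
powers of one. The matrices `X^{[i]}`, of size `(W₁)^i`, are therefore assembled into one block diagonal
matrix `X'`. Its rows and columns are indexed by the pairs `⟨i, r⟩`, so that it has size
`⟨b, |W₁|⟩`, and the list of its powers up to exponent `|W₂|` contains all the powers required. The
defining formula `starFormula` says that there are `X'`, the list `Y'` of its powers and the string
`Z'` of partial sums, such that `Y` consists of the entries of `Y'` within the blocks.

In a model of `V⊕L`, the strings `X'` and `Y` exist by comprehension and `Y'`, `Z'` by `PS₂`. For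
uniqueness it has to be seen that a matrix has only one list of powers
(`Struct.IsPowSeq.unique`); this is an induction on the exponent, with an induction on the number
of summands of a matrix entry inside, both for `Σ₀ᴮ` formulas. The rest is extensionality. Since the
formula mentions the same pairing terms in all places, no property of the pairing function is used
in the theory, only the order axioms and induction (`Struct.induction`), which follows from
comprehension and the length axioms.

In the standard model, where pairing is injective, `Y'` is the list of actual powers
(`NatIsPowSeq.eq_powSeq`) and block `i` of a power of `X'` is the power of block `i`
(`strMatrix_blockDiagonal_pow`).
-/

namespace TwoSorted

/-! ### Semantics of the abbreviations -/

namespace Struct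

/-- The strict order of a structure, as abbreviated in formulas. -/
def lt (M : Struct.{u, v}) (a b : M.Num) : Prop := M.le a b ∧ a ≠ b

/-- The value `(a + b)(a + b + 1) + 2b` of the pairing term. -/
def pair (M : Struct.{u, v}) (a b : M.Num) : M.Num :=
  M.add (M.mul (M.add a b) (M.add (M.add a b) M.one)) (M.mul (M.add M.one M.one) b)

end Struct

section Semantics

variable {M : Struct.{u, v}} {n m n' m' : ℕ} {e : Fin n → M.Num} {E : Fin m → M.Str}

namespace NumTerm

@[simp] lemma val_var (i : Fin n) : (var i : NumTerm n m).val M e E = e i := rfl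
@[simp] lemma val_zero : (0 : NumTerm n m).val M e E = M.zero := rfl
@[simp] lemma val_one : (1 : NumTerm n m).val M e E = M.one := rfl
@[simp] lemma val_add (s t : NumTerm n m) :
    (s + t).val M e E = M.add (s.val M e E) (t.val M e E) := rfl
@[simp] lemma val_mul (s t : NumTerm n m) :
    (s * t).val M e E = M.mul (s.val M e E) (t.val M e E) := rfl
@[simp] lemma val_len (X : Fin m) : (len X : NumTerm n m).val M e E = M.len (E X) := rfl
@[simp] lemma val_pair (s t : NumTerm n m) :
    (pair s t).val M e E = M.pair (s.val M e E) (t.val M e E) := rfl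

lemma val_rename (f : Fin n' → Fin n) (g : Fin m' → Fin m) (t : NumTerm n' m') :
    (t.rename f g).val M e E = t.val M (e ∘ f) (E ∘ g) := by
  induction t with
  | add s t hs ht => simp only [rename, val, hs, ht]
  | mul s t hs ht => simp only [rename, val, hs, ht]
  | _ => rfl

@[simp] lemma val_rename_succ (a : M.Num) (t : NumTerm n m) :
    (t.rename Fin.succ id).val M (Matrix.vecCons a e) E = t.val M e E := val_rename _ _ _

@[simp] lemma val_rename_succ_str (A : M.Str) (t : NumTerm n m) :
    (t.rename id Fin.succ).val M e (Matrix.vecCons A E) = t.val M e E := val_rename _ _ _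

lemma rename_rename {n'' m'' : ℕ} (f : Fin n → Fin n') (g : Fin m → Fin m')
    (f' : Fin n' → Fin n'') (g' : Fin m' → Fin m'') (t : NumTerm n m) :
    (t.rename f g).rename f' g' = t.rename (f' ∘ f) (g' ∘ g) := by
  induction t with
  | add s t hs ht => simp only [rename, hs, ht]
  | mul s t hs ht => simp only [rename, hs, ht]
  | _ => rfl

end NumTerm

lemma vecCons_comp_liftRen {α : Type*} (a : α) (e : Fin n → α) (f : Fin n' → Fin n) :
    Matrix.vecCons a e ∘ liftRen f = Matrix.vecCons a (e ∘ f) := by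
  funext i
  refine Fin.cases ?_ (fun i => ?_) i <;> rfl

namespace Fml

lemma holds_rename (φ : Fml n' m') : ∀ {n m : ℕ} (f : Fin n' → Fin n) (g : Fin m' → Fin m)
    (e : Fin n → M.Num) (E : Fin m → M.Str),
    (φ.rename f g).Holds M e E ↔ φ.Holds M (e ∘ f) (E ∘ g) := by
  induction φ <;> intro n m f g e E <;>
    simp only [rename, Holds, NumTerm.val_rename, vecCons_comp_liftRen, Function.comp_apply, *]

@[simp] lemma holds_imp (φ ψ : Fml n m) :
    (imp φ ψ).Holds M e E ↔ (φ.Holds M e E → ψ.Holds M e E) := by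
  simp only [imp, Holds]; tauto

@[simp] lemma holds_iff (φ ψ : Fml n m) :
    (iff φ ψ).Holds M e E ↔ (φ.Holds M e E ↔ ψ.Holds M e E) := by
  simp only [iff, Holds, holds_imp]; tauto

@[simp] lemma holds_xor (φ ψ : Fml n m) :
    (xor φ ψ).Holds M e E ↔ ¬ (φ.Holds M e E ↔ ψ.Holds M e E) := by
  simp only [xor, Holds]; tauto

@[simp] lemma holds_lt (s t : NumTerm n m) :
    (lt s t).Holds M e E ↔ M.lt (s.val M e E) (t.val M e E) := Iff.rfl

@[simp] lemma holds_exLe (t : NumTerm n m) (φ : Fml (n + 1) m) :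
    (exLe t φ).Holds M e E ↔
      ∃ a, M.le a (t.val M e E) ∧ φ.Holds M (Matrix.vecCons a e) E := by
  simp [exLe, Holds]

@[simp] lemma holds_allLe (t : NumTerm n m) (φ : Fml (n + 1) m) :
    (allLe t φ).Holds M e E ↔
      ∀ a, M.le a (t.val M e E) → φ.Holds M (Matrix.vecCons a e) E := by
  simp [allLe, Holds]

@[simp] lemma holds_exLt (t : NumTerm n m) (φ : Fml (n + 1) m) :
    (exLt t φ).Holds M e E ↔
      ∃ a, M.lt a (t.val M e E) ∧ φ.Holds M (Matrix.vecCons a e) E := by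
  simp only [exLt, Holds, holds_exLe, holds_lt, NumTerm.val_rename_succ, NumTerm.val_var,
    Matrix.cons_val_zero]
  exact exists_congr fun a => ⟨fun h => h.2, fun h => ⟨h.1.1, h⟩⟩

@[simp] lemma holds_allLt (t : NumTerm n m) (φ : Fml (n + 1) m) :
    (allLt t φ).Holds M e E ↔
      ∀ a, M.lt a (t.val M e E) → φ.Holds M (Matrix.vecCons a e) E := by
  simp only [allLt, holds_imp, holds_allLe, holds_lt, NumTerm.val_rename_succ, NumTerm.val_var,
    Matrix.cons_val_zero]
  exact forall_congr' fun a => ⟨fun h h' => h h'.1 h', fun h _ h' => h h'⟩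

@[simp] lemma holds_exStrLe (t : NumTerm n m) (φ : Fml n (m + 1)) :
    (exStrLe t φ).Holds M e E ↔
      ∃ A, M.le (M.len A) (t.val M e E) ∧ φ.Holds M e (Matrix.vecCons A E) := by
  simp [exStrLe, Holds]

lemma holds_exUniqueStr (φ : Fml n (m + 1)) :
    φ.exUniqueStr.Holds M e E ↔ ∃! A, φ.Holds M e (Matrix.vecCons A E) := by
  have h : ∀ A B : M.Str, (Matrix.vecCons B (Matrix.vecCons A E)) ∘
      (Matrix.vecCons 0 (fun i => i.succ.succ) : Fin (m + 1) → Fin (m + 1 + 1)) =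
      Matrix.vecCons B E := by
    intro A B
    funext i
    refine Fin.cases ?_ (fun i => ?_) i <;> rfl
  simp only [exUniqueStr, Holds, holds_imp, holds_rename, h, Function.comp_id, ExistsUnique]
  exact exists_congr fun A => and_congr_right fun _ => forall_congr' fun B =>
    imp_congr_right fun _ => ⟨fun h => h.symm, fun h => h.symm⟩

end Fml

/-! ### Closure properties of `Σ₀ᴮ` formulas -/

namespace IsSigmaB0

lemma imp {φ ψ : Fml n m} (hφ : IsSigmaB0 φ) (hψ : IsSigmaB0 ψ) : IsSigmaB0 (φ.imp ψ) :=
  .or (.not hφ) hψ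

lemma iff {φ ψ : Fml n m} (hφ : IsSigmaB0 φ) (hψ : IsSigmaB0 ψ) : IsSigmaB0 (φ.iff ψ) :=
  .and (hφ.imp hψ) (hψ.imp hφ)

lemma xor {φ ψ : Fml n m} (hφ : IsSigmaB0 φ) (hψ : IsSigmaB0 ψ) : IsSigmaB0 (φ.xor ψ) :=
  .or (.and hφ (.not hψ)) (.and (.not hφ) hψ)

lemma lt (s t : NumTerm n m) : IsSigmaB0 (Fml.lt s t) := .and (.le _ _) (.not (.eqNum _ _))

lemma exLt (t : NumTerm n m) {φ : Fml (n + 1) m} (h : IsSigmaB0 φ) : IsSigmaB0 (Fml.exLt t φ) :=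
  .exLe _ (.and (lt _ _) h)

lemma allLt (t : NumTerm n m) {φ : Fml (n + 1) m} (h : IsSigmaB0 φ) :
    IsSigmaB0 (Fml.allLt t φ) :=
  .allLe _ ((lt _ _).imp h)

lemma rename {φ : Fml n m} (h : IsSigmaB0 φ) : ∀ {n' m' : ℕ} (f : Fin n → Fin n')
    (g : Fin m → Fin m'), IsSigmaB0 (φ.rename f g) := by
  have bound {n m n' m' : ℕ} (f : Fin n → Fin n') (g : Fin m → Fin m') (t : NumTerm n m) :
      (t.rename Fin.succ id).rename (liftRen f) g = (t.rename f g).rename Fin.succ id := by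
    simp only [NumTerm.rename_rename]
    rfl
  induction h with
  | verum => exact fun _ _ => .verum
  | falsum => exact fun _ _ => .falsum
  | eqNum s t => exact fun _ _ => .eqNum _ _
  | eqStr X Y => exact fun _ _ => .eqStr _ _
  | le s t => exact fun _ _ => .le _ _
  | mem t X => exact fun _ _ => .mem _ _
  | not _ ih => exact fun f g => .not (ih f g)
  | and _ _ ih ih' => exact fun f g => .and (ih f g) (ih' f g)
  | or _ _ ih ih' => exact fun f g => .or (ih f g) (ih' f g)
  | exLe t _ ih =>
    intro _ _ f g
    have := IsSigmaB0.exLe (t.rename f g) (ih (liftRen f) g)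
    rw [Fml.exLe, ← bound] at this
    exact this
  | allLe t _ ih =>
    intro _ _ f g
    have := IsSigmaB0.allLe (t.rename f g) (ih (liftRen f) g)
    rw [Fml.allLe, ← bound] at this
    exact this

end IsSigmaB0

end Semantics

/-! ### Order, extensionality and induction in models of `V⁰` -/

namespace Struct

open Matrix (vecCons)

variable {M : Struct.{u, v}} (hM : M.IsModel V0)

include hM

lemma le_antisymm {a b : M.Num} (h : M.le a b) (h' : M.le b a) : a = b := by
  have := hM _ (.basic .B7) ![a, b] ![]
  simp [Fml.Holds] at this
  exact this h h'

lemma le_total (a b : M.Num) : M.le a b ∨ M.le b a := hM _ (.basic .B10) ![a, b] ![]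

lemma le_refl (a : M.Num) : M.le a a := (le_total hM a a).elim id id

lemma zero_le (a : M.Num) : M.le M.zero a := hM _ (.basic .B9) ![a] ![]

lemma le_iff_lt_add_one {a b : M.Num} : M.le a b ↔ M.lt a (M.add b M.one) := by
  have := hM _ (.basic .B11) ![a, b] ![]
  simpa [Fml.Holds] using this

lemma add_one_inj {a b : M.Num} (h : M.add a M.one = M.add b M.one) : a = b := by
  have := hM _ (.basic .B2) ![a, b] ![]
  simp [Fml.Holds] at this
  exact this h

lemma exists_add_one {a : M.Num} (h : a ≠ M.zero) : ∃ b, M.add b M.one = a := by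
  have := hM _ (.basic .B12) ![a] ![]
  simp [Fml.Holds] at this
  obtain ⟨b, -, hb⟩ := this h
  exact ⟨b, hb⟩

lemma lt_len {a : M.Num} {X : M.Str} (h : M.mem a X) : M.lt a (M.len X) := by
  have := hM _ (.basic .L1) ![a] ![X]
  simp [Fml.Holds] at this
  exact this h

lemma mem_of_add_one {a : M.Num} {X : M.Str} (h : M.add a M.one = M.len X) : M.mem a X := by
  have := hM _ (.basic .L2) ![a] ![X]
  simp [Fml.Holds] at this
  exact this h

lemma not_lt_of_le {a b : M.Num} (h : M.le a b) : ¬ M.lt b a :=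
  fun h' => h'.2 (le_antisymm hM h'.1 h)

lemma le_or_lt (a b : M.Num) : M.le a b ∨ M.lt b a := by
  by_cases h : b = a
  · exact .inl (h ▸ le_refl hM b)
  · exact (le_total hM a b).imp id fun h' => ⟨h', h⟩

lemma le_add_one_iff {a b : M.Num} :
    M.le a (M.add b M.one) ↔ M.le a b ∨ a = M.add b M.one := by
  constructor
  · intro h
    by_cases h' : a = M.add b M.one
    · exact .inr h'
    · exact .inl ((le_iff_lt_add_one hM).2 ⟨h, h'⟩)
  · rintro (h | rfl)
    · exact ((le_iff_lt_add_one hM).1 h).1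
    · exact le_refl hM _

lemma add_one_le {a b : M.Num} (h : M.lt a b) : M.le (M.add a M.one) b := by
  rcases le_or_lt hM (M.add a M.one) b with h' | h'
  · exact h'
  · exact absurd h (not_lt_of_le hM ((le_iff_lt_add_one hM).2 h'))

lemma lt_add_one (a : M.Num) : M.lt a (M.add a M.one) :=
  (le_iff_lt_add_one hM).1 (le_refl hM a)

lemma eq_zero_of_le {a : M.Num} (h : M.le a M.zero) : a = M.zero :=
  le_antisymm hM h (zero_le hM a)

/-- Comprehension up to an arbitrary element of the model, for a `Σ₀ᴮ` formula with parameters. -/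
lemma comprehension {n m : ℕ} {φ : Fml (n + 1) m} (hφ : IsSigmaB0 φ) (e : Fin n → M.Num)
    (E : Fin m → M.Str) (y : M.Num) :
    ∃ X, M.le (M.len X) y ∧ ∀ z, M.lt z y → (M.mem z X ↔ φ.Holds M (vecCons z e) E) := by
  have := hM _ (.comp 0 (hφ.rename (liftRen Fin.succ) id)) (vecCons y e) E
  simp only [compAxiom, Fml.holds_exStrLe, Fml.holds_allLt, Fml.holds_iff, Fml.holds_rename,
    Function.comp_id, vecCons_comp_liftRen] at this
  exact this

/-- Induction for `Σ₀ᴮ` formulas. For `y` in the model, comprehension yields the set of all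
`z < y + 1` below which, inclusively, `φ` holds; by the length axioms the length of this set is the
first place where `φ` fails, unless it is `y + 1`. -/
theorem induction {n m : ℕ} {φ : Fml (n + 1) m} (hφ : IsSigmaB0 φ) {e : Fin n → M.Num}
    {E : Fin m → M.Str} (zero : φ.Holds M (vecCons M.zero e) E)
    (succ : ∀ x, φ.Holds M (vecCons x e) E → φ.Holds M (vecCons (M.add x M.one) e) E)
    (y : M.Num) : φ.Holds M (vecCons y e) E := by
  obtain ⟨Y, hYlen, hY⟩ := comprehension hM (φ := Fml.allLe (.var 0) (φ.rename (liftRen Fin.succ) id))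
    (.allLe _ (hφ.rename _ _)) e E (M.add y M.one)
  simp only [Fml.holds_allLe, Fml.holds_rename, vecCons_comp_liftRen] at hY
  change ∀ z, _ → (_ ↔ ∀ a, M.le a z → φ.Holds M (vecCons a e) E) at hY
  by_cases h0 : M.len Y = M.zero
  · have hlt := (le_iff_lt_add_one hM).1 (zero_le hM y)
    have : M.mem M.zero Y := (hY _ hlt).2 fun a ha => by rwa [eq_zero_of_le hM ha]
    have := lt_len hM this
    exact absurd h0.symm this.2
  obtain ⟨z, hz⟩ := exists_add_one hM h0
  have hzY := mem_of_add_one hM hz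
  have hzy : M.lt z (M.add y M.one) := by
    rcases le_or_lt hM (M.add y M.one) z with h | h
    · have := (le_iff_lt_add_one hM).1 h
      rw [hz] at this
      exact absurd this (not_lt_of_le hM hYlen)
    · exact h
  have hall := (hY z hzy).1 hzY
  by_cases heq : M.add z M.one = M.add y M.one
  · rw [← add_one_inj hM heq]
    exact hall z (le_refl hM z)
  · have : M.mem (M.add z M.one) Y := (hY _ ⟨hz ▸ hYlen, heq⟩).2 fun a ha => by
      rcases (le_add_one_iff hM).1 ha with h | rfl
      · exact hall a h
      · exact succ z (hall z (le_refl hM z))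
    exact absurd hz (lt_len hM this).2

lemma le_trans {a b c : M.Num} (hab : M.le a b) (hbc : M.le b c) : M.le a c := by
  have := induction hM (φ := (Fml.allLe (.var 0) (Fml.allLe (.var 0) (.le (.var 0) (.var 2))) :
    Fml 1 0)) (.allLe _ (.allLe _ (.le _ _))) (e := ![]) (E := ![]) ?_ ?_ c
  · simp [Fml.Holds] at this
    exact this b hbc a hab
  · simp [Fml.Holds]
    intro a ha b hb
    rwa [eq_zero_of_le hM ha] at hb
  · simp [Fml.Holds]
    intro x ih a ha b hb
    rcases (le_add_one_iff hM).1 ha with h | rfl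
    · exact (le_add_one_iff hM).2 (.inl (ih a h b hb))
    · exact hb

lemma lt_of_lt_of_le {a b c : M.Num} (hab : M.lt a b) (hbc : M.le b c) : M.lt a c := by
  refine ⟨le_trans hM hab.1 hbc, ?_⟩
  rintro rfl
  exact not_lt_of_le hM hbc hab

lemma len_le_of_subset {X Y : M.Str} (h : ∀ z, M.mem z X → M.mem z Y) :
    M.le (M.len X) (M.len Y) := by
  by_cases h0 : M.len X = M.zero
  · exact h0 ▸ zero_le hM _
  · obtain ⟨z, hz⟩ := exists_add_one hM h0
    rw [← hz]
    exact add_one_le hM (lt_len hM (h z (mem_of_add_one hM hz)))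

lemma str_ext {X Y : M.Str} (h : ∀ z, M.mem z X ↔ M.mem z Y) : X = Y := by
  have := hM _ (.basic .SE) ![] ![X, Y]
  simp [Fml.Holds] at this
  exact this (le_antisymm hM (len_le_of_subset hM fun z => (h z).1)
    (len_le_of_subset hM fun z => (h z).2)) fun z _ => h z

/-- A string is determined by a bound on its length and its bits below this bound. -/
lemma str_ext_of_le {X Y : M.Str} {t : M.Num} (hX : M.le (M.len X) t) (hY : M.le (M.len Y) t)
    (h : ∀ z, M.lt z t → (M.mem z X ↔ M.mem z Y)) : X = Y :=
  str_ext hM fun z =>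
    ⟨fun hz => (h z (lt_of_lt_of_le hM (lt_len hM hz) hX)).1 hz,
      fun hz => (h z (lt_of_lt_of_le hM (lt_len hM hz) hY)).2 hz⟩

end Struct

/-! ### The list of powers is unique -/

namespace Struct

/-- `Y` is the list of the powers with exponent at most `k` of the `n × n` matrix `X`, and `Z` lists
the partial sums that occur in the matrix products: the meaning of `powSeqWitness`, with the bound
`b < |Y|` omitted because it follows from `Y(b)`. -/
structure IsPowSeq (M : Struct.{u, v}) (n k : M.Num) (Z Y X : M.Str) : Prop where
  eq_pair : ∀ b, M.mem b Y → ∃ i, M.le i k ∧ ∃ r, M.lt r n ∧ ∃ c, M.lt c n ∧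
    b = M.pair i (M.pair r c)
  one_iff : ∀ r, M.lt r n → ∀ c, M.lt c n →
    (M.mem (M.pair M.zero (M.pair r c)) Y ↔ r = c)
  sum_zero : ∀ i, M.lt i k → ∀ r, M.lt r n → ∀ c, M.lt c n →
    ¬ M.mem (M.pair i (M.pair (M.pair r c) M.zero)) Z
  sum_succ : ∀ i, M.lt i k → ∀ r, M.lt r n → ∀ c, M.lt c n → ∀ l, M.lt l n →
    (M.mem (M.pair i (M.pair (M.pair r c) (M.add l M.one))) Z ↔
      ¬ (M.mem (M.pair i (M.pair (M.pair r c) l)) Z ↔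
        M.mem (M.pair r l) X ∧ M.mem (M.pair i (M.pair l c)) Y))
  succ_iff : ∀ i, M.lt i k → ∀ r, M.lt r n → ∀ c, M.lt c n →
    (M.mem (M.pair (M.add i M.one) (M.pair r c)) Y ↔
      M.mem (M.pair i (M.pair (M.pair r c) n)) Z)

variable {M : Struct.{u, v}}

lemma holds_powSeqWitness (hL : ∀ a X, M.mem a X → M.lt a (M.len X)) {n k : M.Num}
    {Z Y X : M.Str} : powSeqWitness.Holds M ![n, k] ![Z, Y, X] ↔ M.IsPowSeq n k Z Y X := by
  simp [powSeqWitness, Fml.Holds]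
  constructor
  · rintro ⟨h₁, h₂, h₃⟩
    exact ⟨fun b hb => h₁ b (hL b Y hb) hb, h₂, fun i hi r hr c hc => (h₃ i hi r hr c hc).1,
      fun i hi r hr c hc => (h₃ i hi r hr c hc).2.1, fun i hi r hr c hc => (h₃ i hi r hr c hc).2.2⟩
  · rintro ⟨h₁, h₂, h₃, h₄, h₅⟩
    exact ⟨fun b _ => h₁ b, h₂, fun i hi r hr c hc =>
      ⟨h₃ i hi r hr c hc, h₄ i hi r hr c hc, h₅ i hi r hr c hc⟩⟩

namespace IsPowSeq

variable (hM : M.IsModel V0) {n k : M.Num} {Z Z' Y Y' X : M.Str}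

include hM

/-- Two computations of the same power agree at exponent `i + 1` if they do at `i`: the partial sums
agree, by induction on the number of summands. -/
lemma mem_succ_iff (h : M.IsPowSeq n k Z Y X) (h' : M.IsPowSeq n k Z' Y' X) {i : M.Num}
    (hi : M.lt i k)
    (ih : ∀ r, M.lt r n → ∀ c, M.lt c n →
      (M.mem (M.pair i (M.pair r c)) Y ↔ M.mem (M.pair i (M.pair r c)) Y'))
    {r c : M.Num} (hr : M.lt r n) (hc : M.lt c n) :
    M.mem (M.pair (M.add i M.one) (M.pair r c)) Y ↔
      M.mem (M.pair (M.add i M.one) (M.pair r c)) Y' := by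
  rw [h.succ_iff i hi r hr c hc, h'.succ_iff i hi r hr c hc]
  have := induction hM
    (φ := (Fml.imp (.le (.var 0) (.var 4))
      (.iff (.mem (.pair (.var 1) (.pair (.pair (.var 2) (.var 3)) (.var 0))) 0)
        (.mem (.pair (.var 1) (.pair (.pair (.var 2) (.var 3)) (.var 0))) 1)) : Fml 5 2))
    (.imp (.le _ _) (.iff (.mem _ _) (.mem _ _))) (e := ![i, r, c, n]) (E := ![Z, Z']) ?_ ?_ n
  · simp [Fml.Holds] at this
    exact this (le_refl hM n)
  · simp [Fml.Holds]
    intro _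
    exact iff_of_false (h.sum_zero i hi r hr c hc) (h'.sum_zero i hi r hr c hc)
  · simp [Fml.Holds]
    intro l ihl hl
    -- Summand `l` is the same in both computations by the hypothesis on exponent `i`.
    have hln := lt_of_lt_of_le hM (lt_add_one hM l) hl
    rw [h.sum_succ i hi r hr c hc l hln, h'.sum_succ i hi r hr c hc l hln, ihl hln.1,
      ih l hln c hc]

/-- A matrix has only one list of powers, by induction on the exponent. -/
theorem unique (h : M.IsPowSeq n k Z Y X) (h' : M.IsPowSeq n k Z' Y' X) : Y = Y' := by
  have key : ∀ i, M.le i k → ∀ r, M.lt r n → ∀ c, M.lt c n →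
      (M.mem (M.pair i (M.pair r c)) Y ↔ M.mem (M.pair i (M.pair r c)) Y') := by
    intro i
    have := induction hM
      (φ := (Fml.imp (.le (.var 0) (.var 2)) (.allLt (.var 1) (.allLt (.var 2)
        (.iff (.mem (.pair (.var 2) (.pair (.var 1) (.var 0))) 0)
          (.mem (.pair (.var 2) (.pair (.var 1) (.var 0))) 1)))) : Fml 3 2))
      (.imp (.le _ _) (.allLt _ (.allLt _ (.iff (.mem _ _) (.mem _ _)))))
      (e := ![n, k]) (E := ![Y, Y']) ?_ ?_ i
    · simpa [Fml.Holds] using this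
    · simp [Fml.Holds]
      intro _ r hr c hc
      rw [h.one_iff r hr c hc, h'.one_iff r hr c hc]
    · simp [Fml.Holds]
      intro i ih hi r hr c hc
      have hik := lt_of_lt_of_le hM (lt_add_one hM i) hi
      exact mem_succ_iff hM h h' hik (ih hik.1) hr hc
  refine str_ext hM fun z => ⟨fun hz => ?_, fun hz => ?_⟩
  · obtain ⟨i, hi, r, hr, c, hc, rfl⟩ := h.eq_pair z hz
    exact (key i hi r hr c hc).1 hz
  · obtain ⟨i, hi, r, hr, c, hc, rfl⟩ := h'.eq_pair z hz
    exact (key i hi r hr c hc).2 hz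

end IsPowSeq

end Struct

/-! ### The defining formula -/

section Formulas

open Fml NumTerm

variable {n m : ℕ}

/-- `r < (W)^i`, without the function `(W)^i`: no `y ≤ r` belongs to row `i` of `W`. -/
def ltSeq (i r : NumTerm n m) (W : Fin m) : Fml n m :=
  and (lt r (len W)) (allLe r (not (mem (pair (i.rename Fin.succ id) (var 0)) W)))

/-- `j ≤ (W)^i`, without the function `(W)^i`: no `y < j` belongs to row `i` of `W`. -/
def leSeq (i j : NumTerm n m) (W : Fin m) : Fml n m :=
  and (le j (len W)) (allLt j (not (mem (pair (i.rename Fin.succ id) (var 0)) W)))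

/-- Bit `z` of the block diagonal matrix whose row and column indices are the pairs `⟨i, r⟩` and
whose block `i < b` is the square matrix `X^{[i]}` of size `(W₁)^i`. Free variables: numbers `z = 0`,
`b = 1`; strings `W₁ = 0`, `X = 1`. -/
def blockDiagonalBit : Fml 2 2 :=
  exLt (var 1) (exLt (len 0) (exLt (len 0)
    (and (and (ltSeq (var 2) (var 1) 0) (ltSeq (var 2) (var 0) 0))
      (and (mem (pair (var 2) (pair (var 1) (var 0))) 1)
        (eqNum (var 3) (pair (pair (var 2) (var 1)) (pair (var 2) (var 0))))))))

/-- Bit `z` of the aggregate function, read off the list `Y'` of the powers of the block diagonal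
matrix: `z = ⟨i, ⟨j, ⟨r, c⟩⟩⟩` with `i < b`, `j ≤ (W₂)^i`, `r, c < (W₁)^i`, and the entry of row
`⟨i, r⟩` and column `⟨i, c⟩` of power `j` is one. Free variables: numbers `z = 0`, `b = 1`; strings
`Y' = 0`, `W₁ = 1`, `W₂ = 2`. -/
def blockEntryBit : Fml 2 3 :=
  exLt (var 1) (exLe (len 2) (exLt (len 1) (exLt (len 1)
    (and (and (leSeq (var 3) (var 2) 2) (and (ltSeq (var 3) (var 1) 1) (ltSeq (var 3) (var 0) 1)))
      (and (mem (pair (var 2) (pair (pair (var 3) (var 1)) (pair (var 3) (var 0)))) 0)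
        (eqNum (var 4) (pair (var 3) (pair (var 2) (pair (var 1) (var 0))))))))))

/-- The size `⟨b, |W|⟩` of the block diagonal matrix. -/
def blockSize (b : NumTerm n m) (W : Fin m) : NumTerm n m := pair b (len W)

/-- A bound on the length of the aggregate of `b` lists of powers. -/
def starBound (b : NumTerm n m) (W₁ W₂ : Fin m) : NumTerm n m :=
  pair b (pair (len W₂) (pair (len W₁) (len W₁)))

/-- The `Σ₁ᴮ` formula that defines the aggregate function: there are a block diagonal matrix `X'`, the
list `Y'` of its powers and the string `Z'` of partial sums, such that `Y` consists of the entries of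
`Y'` inside the blocks. Free variables: number `b = 0`; strings `Y = 0`, `W₁ = 1`, `W₂ = 2`, `X = 3`.
Since only variables can be renamed in `powSeqWitness`, its variables `n` and `k` are introduced by
bounded quantifiers and equated with the terms `⟨b, |W₁|⟩` and `|W₂|`.

Under the three string quantifiers `Z' = 0`, `Y' = 1`, `X' = 2`, and the indices of the free string
variables grow by three. -/
def starFormula : Fml 1 4 :=
  exStrLe (pair (blockSize (var 0) 1) (blockSize (var 0) 1))
    (exStrLe (pair (len 3) (pair (blockSize (var 0) 2) (blockSize (var 0) 2)))
      (exStrLe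
        (pair (len 4) (pair (pair (blockSize (var 0) 3) (blockSize (var 0) 3))
          (blockSize (var 0) 3)))
        (and
          (allLt (pair (blockSize (var 0) 4) (blockSize (var 0) 4))
            (iff (mem (var 0) 2) (blockDiagonalBit.rename id ![4, 6])))
        (and
          (exLe (blockSize (var 0) 4) (exLe (len 5)
            (and (and (eqNum (var 1) (blockSize (var 2) 4)) (eqNum (var 0) (len 5)))
              (powSeqWitness.rename ![1, 0] ![0, 1, 2]))))
        (and
          (le (len 3) (starBound (var 0) 4 5))
          (allLt (starBound (var 0) 4 5)
            (iff (mem (var 0) 3) (blockEntryBit.rename id ![1, 4, 5]))))))))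

lemma isSigmaB0_ltSeq (i r : NumTerm n m) (W : Fin m) : IsSigmaB0 (ltSeq i r W) :=
  .and (.lt _ _) (.allLe _ (.not (.mem _ _)))

lemma isSigmaB0_leSeq (i r : NumTerm n m) (W : Fin m) : IsSigmaB0 (leSeq i r W) :=
  .and (.le _ _) (.allLt _ (.not (.mem _ _)))

lemma isSigmaB0_blockDiagonalBit : IsSigmaB0 blockDiagonalBit :=
  .exLt _ (.exLt _ (.exLt _ (.and (.and (isSigmaB0_ltSeq _ _ _) (isSigmaB0_ltSeq _ _ _))
    (.and (.mem _ _) (.eqNum _ _)))))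

lemma isSigmaB0_blockEntryBit : IsSigmaB0 blockEntryBit :=
  .exLt _ (.exLe _ (.exLt _ (.exLt _ (.and (.and (isSigmaB0_leSeq _ _ _)
    (.and (isSigmaB0_ltSeq _ _ _) (isSigmaB0_ltSeq _ _ _))) (.and (.mem _ _) (.eqNum _ _))))))

lemma isSigmaB0_powSeqWitness : IsSigmaB0 powSeqWitness :=
  .and (.allLt _ (.imp (.mem _ _) (.exLe _ (.exLt _ (.exLt _ (.eqNum _ _))))))
    (.and (.allLt _ (.allLt _ (.iff (.mem _ _) (.eqNum _ _))))
      (.allLt _ (.allLt _ (.allLt _ (.and (.not (.mem _ _)) (.and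
        (.allLt _ (.iff (.mem _ _) (.xor (.mem _ _) (.and (.mem _ _) (.mem _ _)))))
        (.iff (.mem _ _) (.mem _ _))))))))

lemma isSigmaB1_starFormula : IsSigmaB1 starFormula :=
  .exStrLe (pair (blockSize (var 0) 1) (blockSize (var 0) 1))
    (.exStrLe (pair (len 2) (pair (blockSize (var 0) 1) (blockSize (var 0) 1)))
      (.exStrLe
        (pair (len 2) (pair (pair (blockSize (var 0) 1) (blockSize (var 0) 1))
          (blockSize (var 0) 1)))
        (.matrix (.and
          (.allLt _ (.iff (.mem _ _) (isSigmaB0_blockDiagonalBit.rename _ _)))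
        (.and
          (.exLe _ (.exLe _ (.and (.and (.eqNum _ _) (.eqNum _ _))
            (isSigmaB0_powSeqWitness.rename _ _))))
        (.and
          (.le _ _)
          (.allLt _ (.iff (.mem _ _) (isSigmaB0_blockEntryBit.rename _ _)))))))))

end Formulas

namespace Struct

variable (M : Struct.{u, v})

/-- `r < (W)^i`. -/
def LtSeq (i r : M.Num) (W : M.Str) : Prop :=
  M.lt r (M.len W) ∧ ∀ y, M.le y r → ¬ M.mem (M.pair i y) W

/-- `j ≤ (W)^i`. -/
def LeSeq (i j : M.Num) (W : M.Str) : Prop :=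
  M.le j (M.len W) ∧ ∀ y, M.lt y j → ¬ M.mem (M.pair i y) W

/-- The meaning of `blockDiagonalBit`. -/
def BlockDiagonalBit (z b : M.Num) (W₁ X : M.Str) : Prop :=
  ∃ i, M.lt i b ∧ ∃ r, M.lt r (M.len W₁) ∧ ∃ c, M.lt c (M.len W₁) ∧
    (M.LtSeq i r W₁ ∧ M.LtSeq i c W₁) ∧
      M.mem (M.pair i (M.pair r c)) X ∧ z = M.pair (M.pair i r) (M.pair i c)

/-- The meaning of `blockEntryBit`. -/
def BlockEntryBit (z b : M.Num) (Y' W₁ W₂ : M.Str) : Prop :=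
  ∃ i, M.lt i b ∧ ∃ j, M.le j (M.len W₂) ∧ ∃ r, M.lt r (M.len W₁) ∧ ∃ c, M.lt c (M.len W₁) ∧
    (M.LeSeq i j W₂ ∧ M.LtSeq i r W₁ ∧ M.LtSeq i c W₁) ∧
      M.mem (M.pair j (M.pair (M.pair i r) (M.pair i c))) Y' ∧
        z = M.pair i (M.pair j (M.pair r c))

/-- The value of `starBound`. -/
def starBound (b : M.Num) (W₁ W₂ : M.Str) : M.Num :=
  M.pair b (M.pair (M.len W₂) (M.pair (M.len W₁) (M.len W₁)))

/-- `X'` is the block diagonal matrix described by `blockDiagonalBit`. -/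
def IsBlockDiagonal (b : M.Num) (W₁ X X' : M.Str) : Prop :=
  M.le (M.len X') (M.pair (M.pair b (M.len W₁)) (M.pair b (M.len W₁))) ∧
    ∀ z, M.lt z (M.pair (M.pair b (M.len W₁)) (M.pair b (M.len W₁))) →
      (M.mem z X' ↔ M.BlockDiagonalBit z b W₁ X)

/-- `Y` consists of the block entries of `Y'` described by `blockEntryBit`. -/
def IsBlockEntries (b : M.Num) (Y Y' W₁ W₂ : M.Str) : Prop :=
  M.le (M.len Y) (M.starBound b W₁ W₂) ∧
    ∀ z, M.lt z (M.starBound b W₁ W₂) → (M.mem z Y ↔ M.BlockEntryBit z b Y' W₁ W₂)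

variable {M}

lemma holds_blockDiagonalBit {z b : M.Num} {W₁ X : M.Str} :
    blockDiagonalBit.Holds M ![z, b] ![W₁, X] ↔ M.BlockDiagonalBit z b W₁ X := by
  simp [blockDiagonalBit, BlockDiagonalBit, ltSeq, LtSeq, Fml.Holds]

lemma holds_blockEntryBit {z b : M.Num} {Y' W₁ W₂ : M.Str} :
    blockEntryBit.Holds M ![z, b] ![Y', W₁, W₂] ↔ M.BlockEntryBit z b Y' W₁ W₂ := by
  simp [blockEntryBit, BlockEntryBit, ltSeq, LtSeq, leSeq, LeSeq, Fml.Holds]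

lemma holds_starFormula (hle : ∀ a, M.le a a) (hL : ∀ a X, M.mem a X → M.lt a (M.len X))
    {b : M.Num} {Y W₁ W₂ X : M.Str} :
    starFormula.Holds M ![b] ![Y, W₁, W₂, X] ↔
      ∃ X', M.IsBlockDiagonal b W₁ X X' ∧
      ∃ Y', M.le (M.len Y') (M.pair (M.len W₂)
        (M.pair (M.pair b (M.len W₁)) (M.pair b (M.len W₁)))) ∧
      ∃ Z', M.le (M.len Z') (M.pair (M.len W₂)
        (M.pair (M.pair (M.pair b (M.len W₁)) (M.pair b (M.len W₁))) (M.pair b (M.len W₁)))) ∧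
      M.IsPowSeq (M.pair b (M.len W₁)) (M.len W₂) Z' Y' X' ∧
      M.IsBlockEntries b Y Y' W₁ W₂ := by
  have e1 (z : M.Num) (Z' Y' X' : M.Str) :
      (blockDiagonalBit.rename id ![4, 6]).Holds M ![z, b] ![Z', Y', X', Y, W₁, W₂, X] ↔
        M.BlockDiagonalBit z b W₁ X := by
    rw [Fml.holds_rename, ← holds_blockDiagonalBit, Function.comp_id]
    congr! 1
    funext i; fin_cases i <;> rfl
  have e2 (z : M.Num) (Z' Y' X' : M.Str) :
      (blockEntryBit.rename id ![1, 4, 5]).Holds M ![z, b] ![Z', Y', X', Y, W₁, W₂, X] ↔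
        M.BlockEntryBit z b Y' W₁ W₂ := by
    rw [Fml.holds_rename, ← holds_blockEntryBit, Function.comp_id]
    congr! 1
    funext i; fin_cases i <;> rfl
  have e3 (k n : M.Num) (Z' Y' X' : M.Str) :
      (powSeqWitness.rename ![1, 0] ![0, 1, 2]).Holds M ![k, n, b]
        ![Z', Y', X', Y, W₁, W₂, X] ↔ M.IsPowSeq n k Z' Y' X' := by
    rw [Fml.holds_rename, ← holds_powSeqWitness hL]
    congr! 1 <;> funext i <;> fin_cases i <;> rfl
  simp [starFormula, blockSize, TwoSorted.starBound, Fml.Holds, hle, e1, e2, e3]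
  constructor
  · rintro ⟨X', hX', Y', hY', Z', hZ', hd, hp, hl, he⟩
    exact ⟨X', ⟨hX', hd⟩, Y', hY', Z', hZ', hp, hl, he⟩
  · rintro ⟨X', ⟨hX', hd⟩, Y', hY', Z', hZ', hp, hl, he⟩
    exact ⟨X', hX', Y', hY', Z', hZ', hd, hp, hl, he⟩

/-! ### Existence and uniqueness in models of `V⊕L` -/

lemma exists_isPowSeq (hM : M.IsModel VParityL) (n k : M.Num) (X : M.Str) :
    ∃ Y, M.le (M.len Y) (M.pair k (M.pair n n)) ∧
      ∃ Z, M.le (M.len Z) (M.pair k (M.pair (M.pair n n) n)) ∧ M.IsPowSeq n k Z Y X := by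
  have hV : M.IsModel V0 := fun _ _ φ h => hM φ (.base (.base h))
  have := hM _ .powSeq ![n, k] ![X]
  simpa [powSeqAxiom, holds_powSeqWitness fun _ _ => lt_len hV] using this

/-- Each of `X'`, `Y'` and `Y` exists and is determined by the preceding ones; only `Z'` need not be
unique, as its bits outside the partial sums are arbitrary. -/
theorem existsUnique_starFormula (hM : M.IsModel VParityL) (b : M.Num) (W₁ W₂ X : M.Str) :
    ∃! Y, starFormula.Holds M ![b] ![Y, W₁, W₂, X] := by
  have hV : M.IsModel V0 := fun _ _ φ h => hM φ (.base (.base h))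
  simp only [holds_starFormula (le_refl hV) fun _ _ => lt_len hV]
  obtain ⟨X', hX'⟩ : ∃ X', M.IsBlockDiagonal b W₁ X X' := by
    have := comprehension hV isSigmaB0_blockDiagonalBit ![b] ![W₁, X]
      (M.pair (M.pair b (M.len W₁)) (M.pair b (M.len W₁)))
    simp only [holds_blockDiagonalBit] at this
    exact this
  obtain ⟨Y', hY', Z', hZ', hp⟩ := exists_isPowSeq hM (M.pair b (M.len W₁)) (M.len W₂) X'
  obtain ⟨Y, hY⟩ : ∃ Y, M.IsBlockEntries b Y Y' W₁ W₂ := by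
    have := comprehension hV isSigmaB0_blockEntryBit ![b] ![Y', W₁, W₂] (M.starBound b W₁ W₂)
    simp only [holds_blockEntryBit] at this
    exact this
  refine ⟨Y, ⟨X', hX', Y', hY', Z', hZ', hp, hY⟩, ?_⟩
  rintro Y₂ ⟨X₂', hX₂', Y₂', -, Z₂', -, hp₂, hY₂⟩
  obtain rfl : X₂' = X' := str_ext_of_le hV hX₂'.1 hX'.1 fun z hz =>
    (hX₂'.2 z hz).trans (hX'.2 z hz).symm
  obtain rfl : Y₂' = Y' := hp₂.unique hV hp
  exact str_ext_of_le hV hY₂.1 hY.1 fun z hz => (hY₂.2 z hz).trans (hY.2 z hz).symm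

end Struct

/-! ### Pairing, lengths and rows in the standard model -/

lemma natPair_le_natPair {a b c d : ℕ} (h : a ≤ c) (h' : b ≤ d) : natPair a b ≤ natPair c d := by
  unfold natPair; gcongr

lemma natPair_lt_natPair_left {a b c d : ℕ} (h : a < c) (h' : b ≤ d) :
    natPair a b < natPair c d := by
  unfold natPair
  have : (a + b) * (a + b + 1) < (c + d) * (c + d + 1) :=
    Nat.mul_lt_mul'' (by omega) (by omega)
  omega

lemma natPair_lt_natPair_right {a b c d : ℕ} (h : a ≤ c) (h' : b < d) :
    natPair a b < natPair c d := by
  unfold natPair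
  have : (a + b) * (a + b + 1) ≤ (c + d) * (c + d + 1) := by gcongr
  omega

lemma le_natPair_right (a b : ℕ) : b ≤ natPair a b := by
  unfold natPair; omega

lemma natPair_inj {a b c d : ℕ} : natPair a b = natPair c d ↔ a = c ∧ b = d := by
  refine ⟨fun h => ?_, by rintro ⟨rfl, rfl⟩; rfl⟩
  have key : ∀ {a b c d : ℕ}, a + b < c + d → natPair a b < natPair c d := by
    intro a b c d h
    unfold natPair
    have : (a + b + 1) * (a + b + 2) ≤ (c + d) * (c + d + 1) :=
      Nat.mul_le_mul (by omega) (by omega)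
    nlinarith
  have hs : a + b = c + d := by
    rcases lt_trichotomy (a + b) (c + d) with h' | h' | h'
    · exact absurd h (key h').ne
    · exact h'
    · exact absurd h (key h').ne'
  unfold natPair at h
  rw [hs] at h
  omega

lemma lt_strLen {i : ℕ} {X : Finset ℕ} (h : i ∈ X) : i < strLen X :=
  Finset.le_sup (f := fun i => i + 1) h

lemma strLen_le_iff {X : Finset ℕ} {t : ℕ} : strLen X ≤ t ↔ ∀ i ∈ X, i < t :=
  Finset.sup_le_iff

lemma mem_row {x i : ℕ} {Z : Finset ℕ} : i ∈ row x Z ↔ natPair x i ∈ Z := by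
  simp only [row, Finset.mem_filter, Finset.mem_range, and_iff_right_iff_imp]
  exact fun h => (le_natPair_right x i).trans_lt (lt_strLen h)

lemma seq_le (i : ℕ) (W : Finset ℕ) : seq i W ≤ strLen W := by
  unfold seq
  split_ifs with h
  · exact (Nat.find_spec h).1.le
  · exact le_rfl

lemma le_seq_iff {i j : ℕ} {W : Finset ℕ} :
    j ≤ seq i W ↔ j ≤ strLen W ∧ ∀ y, y < j → natPair i y ∉ W := by
  constructor
  · refine fun h => ⟨h.trans (seq_le i W), fun y hy hW => ?_⟩
    have hy' : y < strLen W := (le_natPair_right i y).trans_lt (lt_strLen hW)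
    have hex : ∃ y, y < strLen W ∧ natPair i y ∈ W := ⟨y, hy', hW⟩
    rw [seq, dif_pos hex] at h
    exact Nat.find_min hex (hy.trans_le h) ⟨hy', hW⟩
  · rintro ⟨h, h'⟩
    unfold seq
    split_ifs with hex
    · exact (Nat.le_find_iff _ _).2 fun y hy hW => h' y hy hW.2
    · exact h

lemma lt_seq_iff {i r : ℕ} {W : Finset ℕ} :
    r < seq i W ↔ r < strLen W ∧ ∀ y, y ≤ r → natPair i y ∉ W := by
  rw [← Nat.succ_le_iff, le_seq_iff]
  simp only [Nat.succ_le_iff, Nat.lt_succ_iff]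

lemma mem_powSeq {n k : ℕ} {X : Finset ℕ} {z : ℕ} :
    z ∈ powSeq n k X ↔ ∃ i ≤ k, ∃ r c : Fin n, (strMatrix n X ^ i) r c = 1 ∧
      z = natPair i (natPair r c) := by
  simp only [powSeq, Finset.mem_image, Finset.mem_filter, Finset.mem_product, Finset.mem_range,
    Finset.mem_univ, and_true, Prod.exists, Nat.lt_succ_iff]
  constructor
  · rintro ⟨i, r, c, ⟨hi, h⟩, rfl⟩
    exact ⟨i, hi, r, c, h, rfl⟩
  · rintro ⟨i, hi, r, c, h, rfl⟩
    exact ⟨i, r, c, ⟨hi, h⟩, rfl⟩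

lemma natPair_mem_powSeq {n k : ℕ} {X : Finset ℕ} {i : ℕ} {r c : Fin n} (hi : i ≤ k) :
    natPair i (natPair r c) ∈ powSeq n k X ↔ (strMatrix n X ^ i) r c = 1 := by
  rw [mem_powSeq]
  constructor
  · rintro ⟨i', -, r', c', h, e⟩
    simp only [natPair_inj, Fin.val_inj] at e
    obtain ⟨rfl, rfl, rfl⟩ := e
    exact h
  · exact fun h => ⟨i, hi, r, c, h, rfl⟩

/-! ### Partial sums modulo two -/

lemma zmod_two_add_eq_one_iff (a b : ZMod 2) : a + b = 1 ↔ ¬ (a = 1 ↔ b = 1) := by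
  revert a b; decide

lemma zmod_two_mul_eq_one_iff (a b : ZMod 2) : a * b = 1 ↔ a = 1 ∧ b = 1 := by
  revert a b; decide

lemma strMatrix_eq_one_iff {n : ℕ} {X : Finset ℕ} {r c : Fin n} :
    strMatrix n X r c = 1 ↔ natPair r c ∈ X := by
  simp [strMatrix]

/-- The sum of the first `l` summands of entry `(r, c)` of the product of `X` and `X^i`. -/
def partialSum (n : ℕ) (X : Finset ℕ) (i : ℕ) (r c : Fin n) (l : ℕ) : ZMod 2 :=
  ∑ x : Fin n with x.val < l, strMatrix n X r x * (strMatrix n X ^ i) x c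

lemma partialSum_zero (n : ℕ) (X : Finset ℕ) (i : ℕ) (r c : Fin n) :
    partialSum n X i r c 0 = 0 := by
  simp [partialSum]

lemma partialSum_succ (n : ℕ) (X : Finset ℕ) (i : ℕ) (r c l : Fin n) :
    partialSum n X i r c (l + 1) =
      partialSum n X i r c l + strMatrix n X r l * (strMatrix n X ^ i) l c := by
  have : (Finset.univ.filter fun x : Fin n => x.val < l.val + 1) =
      insert l (Finset.univ.filter fun x : Fin n => x.val < l.val) := by
    ext x
    simp only [Finset.mem_filter, Finset.mem_univ, true_and, Finset.mem_insert, Fin.ext_iff]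
    omega
  rw [partialSum, this, Finset.sum_insert (by simp), add_comm]
  rfl

lemma partialSum_self (n : ℕ) (X : Finset ℕ) (i : ℕ) (r c : Fin n) :
    partialSum n X i r c n = (strMatrix n X ^ (i + 1)) r c := by
  simp [partialSum, pow_succ', Matrix.mul_apply]

/-! ### The formula for powers in the standard model -/

/-- The conditions of `Struct.IsPowSeq` in the standard model. -/
structure NatIsPowSeq (n k : ℕ) (Z Y X : Finset ℕ) : Prop where
  eq_pair : ∀ b ∈ Y, ∃ i ≤ k, ∃ r c : Fin n, b = natPair i (natPair r c)
  one_iff : ∀ r c : Fin n, natPair 0 (natPair r c) ∈ Y ↔ r = c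
  sum_zero : ∀ i < k, ∀ r c : Fin n, natPair i (natPair (natPair r c) 0) ∉ Z
  sum_succ : ∀ i < k, ∀ r c l : Fin n,
    natPair i (natPair (natPair r c) (l + 1)) ∈ Z ↔
      ¬ (natPair i (natPair (natPair r c) l) ∈ Z ↔
        natPair r l ∈ X ∧ natPair i (natPair l c) ∈ Y)
  succ_iff : ∀ i < k, ∀ r c : Fin n,
    natPair (i + 1) (natPair r c) ∈ Y ↔ natPair i (natPair (natPair r c) n) ∈ Z

lemma standardModel_lt {a b : ℕ} : standardModel.lt a b ↔ a < b := lt_iff_le_and_ne.symm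

lemma isPowSeq_standardModel {n k : ℕ} {Z Y X : Finset ℕ} :
    standardModel.IsPowSeq n k Z Y X ↔ NatIsPowSeq n k Z Y X := by
  constructor
  · intro h
    refine ⟨fun b hb => ?_, fun r c => ?_, fun i hi r c => ?_, fun i hi r c l => ?_,
      fun i hi r c => ?_⟩
    · obtain ⟨i, hi, r, hr, c, hc, rfl⟩ := h.eq_pair b hb
      exact ⟨i, hi, ⟨r, standardModel_lt.1 hr⟩, ⟨c, standardModel_lt.1 hc⟩, rfl⟩
    · exact (h.one_iff _ (standardModel_lt.2 r.2) _ (standardModel_lt.2 c.2)).trans Fin.val_inj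
    · exact h.sum_zero i (standardModel_lt.2 hi) _ (standardModel_lt.2 r.2) _
        (standardModel_lt.2 c.2)
    · exact h.sum_succ i (standardModel_lt.2 hi) _ (standardModel_lt.2 r.2) _
        (standardModel_lt.2 c.2) _ (standardModel_lt.2 l.2)
    · exact h.succ_iff i (standardModel_lt.2 hi) _ (standardModel_lt.2 r.2) _
        (standardModel_lt.2 c.2)
  · intro h
    refine ⟨fun b hb => ?_, fun r hr c hc => ?_, fun i hi r hr c hc => ?_,
      fun i hi r hr c hc l hl => ?_, fun i hi r hr c hc => ?_⟩
    · obtain ⟨i, hi, r, c, rfl⟩ := h.eq_pair b hb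
      exact ⟨i, hi, r.val, standardModel_lt.2 r.2, c.val, standardModel_lt.2 c.2, rfl⟩
    · exact (h.one_iff ⟨r, standardModel_lt.1 hr⟩ ⟨c, standardModel_lt.1 hc⟩).trans Fin.ext_iff
    · exact h.sum_zero i (standardModel_lt.1 hi) ⟨r, standardModel_lt.1 hr⟩
        ⟨c, standardModel_lt.1 hc⟩
    · exact h.sum_succ i (standardModel_lt.1 hi) ⟨r, standardModel_lt.1 hr⟩
        ⟨c, standardModel_lt.1 hc⟩ ⟨l, standardModel_lt.1 hl⟩
    · exact h.succ_iff i (standardModel_lt.1 hi) ⟨r, standardModel_lt.1 hr⟩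
        ⟨c, standardModel_lt.1 hc⟩

lemma NatIsPowSeq.eq_powSeq {n k : ℕ} {Z Y X : Finset ℕ} (h : NatIsPowSeq n k Z Y X) :
    Y = powSeq n k X := by
  have key : ∀ i ≤ k, ∀ r c : Fin n,
      natPair i (natPair r c) ∈ Y ↔ (strMatrix n X ^ i) r c = 1 := by
    intro i
    induction i with
    | zero =>
      intro _ r c
      rw [h.one_iff, pow_zero, Matrix.one_apply]
      simp
    | succ i ih =>
      intro hi r c
      have hsum : ∀ l ≤ n, natPair i (natPair (natPair r c) l) ∈ Z ↔
          partialSum n X i r c l = 1 := by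
        intro l
        induction l with
        | zero =>
          intro _
          simp [partialSum_zero, h.sum_zero i hi r c]
        | succ l ihl =>
          intro hl
          have := h.sum_succ i hi r c ⟨l, hl⟩
          have e := partialSum_succ n X i r c ⟨l, hl⟩
          simp only at this e
          rw [this, e, zmod_two_add_eq_one_iff, zmod_two_mul_eq_one_iff,
            strMatrix_eq_one_iff, ← ih (by omega), ihl (by omega)]
      rw [h.succ_iff i hi, hsum n le_rfl, partialSum_self]
  ext z
  constructor
  · intro hz
    obtain ⟨i, hi, r, c, rfl⟩ := h.eq_pair z hz
    exact (natPair_mem_powSeq hi).2 ((key i hi r c).1 hz)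
  · intro hz
    obtain ⟨i, hi, r, c, h1, rfl⟩ := mem_powSeq.1 hz
    exact (key i hi r c).2 h1

/-- In the standard model the list of powers exists, with bounds as in the axiom `PS₂`. -/
lemma exists_natIsPowSeq (n k : ℕ) (X : Finset ℕ) :
    strLen (powSeq n k X) ≤ natPair k (natPair n n) ∧
      ∃ Z, strLen Z ≤ natPair k (natPair (natPair n n) n) ∧
        NatIsPowSeq n k Z (powSeq n k X) X := by
  refine ⟨strLen_le_iff.2 fun z hz => ?_, ?_⟩
  · obtain ⟨i, hi, r, c, -, rfl⟩ := mem_powSeq.1 hz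
    exact natPair_lt_natPair_right hi (natPair_lt_natPair_left r.2 c.2.le)
  -- `Z` consists of the codes of the partial sums, with up to `n` summands, that are one.
  let Z : Finset ℕ := ((Finset.range k ×ˢ ((Finset.univ : Finset (Fin n × Fin n)) ×ˢ
    Finset.range (n + 1))).filter
      (fun p => partialSum n X p.1 p.2.1.1 p.2.1.2 p.2.2 = 1)).image
    (fun p => natPair p.1 (natPair (natPair p.2.1.1 p.2.1.2) p.2.2))
  have hZ (i : ℕ) (hi : i < k) (r c : Fin n) (l : ℕ) (hl : l ≤ n) :
      natPair i (natPair (natPair r c) l) ∈ Z ↔ partialSum n X i r c l = 1 := by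
    simp only [Z, Finset.mem_image, Finset.mem_filter, Finset.mem_product, Finset.mem_range,
      Finset.mem_univ, true_and, Prod.exists, natPair_inj, Fin.val_inj]
    constructor
    · rintro ⟨i', r', c', l', ⟨-, h⟩, rfl, ⟨rfl, rfl⟩, rfl⟩
      exact h
    · exact fun h => ⟨i, r, c, l, ⟨⟨hi, by omega⟩, h⟩, rfl, ⟨rfl, rfl⟩, rfl⟩
  refine ⟨Z, strLen_le_iff.2 fun z hz => ?_, ?_, ?_, ?_, ?_, ?_⟩
  · simp only [Z, Finset.mem_image, Finset.mem_filter, Finset.mem_product, Finset.mem_range,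
      Finset.mem_univ, true_and, Prod.exists] at hz
    obtain ⟨i, r, c, l, ⟨⟨hi, hl⟩, -⟩, rfl⟩ := hz
    exact natPair_lt_natPair_left hi
      (natPair_le_natPair (natPair_le_natPair r.2.le c.2.le) (by omega))
  · intro z hz
    obtain ⟨i, hi, r, c, -, rfl⟩ := mem_powSeq.1 hz
    exact ⟨i, hi, r, c, rfl⟩
  · intro r c
    have := natPair_mem_powSeq (X := X) (r := r) (c := c) (Nat.zero_le k)
    rw [this, pow_zero, Matrix.one_apply]
    simp
  · intro i hi r c
    rw [hZ i hi r c 0 (Nat.zero_le n), partialSum_zero]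
    simp
  · intro i hi r c l
    rw [hZ i hi r c _ l.2, hZ i hi r c _ l.2.le, partialSum_succ, zmod_two_add_eq_one_iff,
      zmod_two_mul_eq_one_iff, strMatrix_eq_one_iff, natPair_mem_powSeq hi.le]
  · intro i hi r c
    rw [hZ i hi r c n le_rfl, natPair_mem_powSeq hi, partialSum_self]

/-! ### Powers of the block diagonal matrix -/

/-- The block of power `j` of a matrix `A` whose rows with index in the range of `f` vanish outside
this range is power `j` of the block `B` of `A`. -/
lemma pow_apply_of_block {ι κ R : Type*} [Fintype ι] [Fintype κ] [DecidableEq ι] [DecidableEq κ]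
    [Semiring R] {A : Matrix ι ι R} {B : Matrix κ κ R} {f : κ → ι} (hf : Function.Injective f)
    (hB : ∀ r c, A (f r) (f c) = B r c) (hA : ∀ r x, x ∉ Set.range f → A (f r) x = 0) (j : ℕ) :
    ∀ r c, (A ^ j) (f r) (f c) = (B ^ j) r c := by
  induction j with
  | zero => intro r c; simp [Matrix.one_apply, hf.eq_iff]
  | succ j ih =>
    intro r c
    rw [pow_succ', pow_succ', Matrix.mul_apply, Matrix.mul_apply]
    refine (Fintype.sum_of_injective f hf _ _ (fun x hx => ?_) fun x => ?_).symm
    · rw [hA r x hx, zero_mul]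
    · rw [hB, ih]

/-- The block diagonal matrix with index set below `⟨b, |W|⟩`, as a string: block `i < b` is the
matrix of size `(W)^i` that is encoded by `X^{[i]}`. -/
def blockDiagonal (b : ℕ) (W X : Finset ℕ) : Finset ℕ :=
  (Finset.range b).biUnion fun i =>
    ((Finset.range (seq i W) ×ˢ Finset.range (seq i W)).filter
      fun p => natPair p.1 p.2 ∈ row i X).image
        fun p => natPair (natPair i p.1) (natPair i p.2)

lemma mem_blockDiagonal {b : ℕ} {W X : Finset ℕ} {z : ℕ} :
    z ∈ blockDiagonal b W X ↔ ∃ i < b, ∃ r < seq i W, ∃ c < seq i W,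
      natPair i (natPair r c) ∈ X ∧ z = natPair (natPair i r) (natPair i c) := by
  simp only [blockDiagonal, Finset.mem_biUnion, Finset.mem_range, Finset.mem_image,
    Finset.mem_filter, Finset.mem_product, Prod.exists, mem_row]
  constructor
  · rintro ⟨i, hi, r, c, ⟨⟨hr, hc⟩, h⟩, rfl⟩
    exact ⟨i, hi, r, hr, c, hc, h, rfl⟩
  · rintro ⟨i, hi, r, hr, c, hc, h, rfl⟩
    exact ⟨i, hi, r, c, ⟨⟨hr, hc⟩, h⟩, rfl⟩

/-- Index `⟨i, r⟩` of the block diagonal matrix. -/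
def blockIndex {b : ℕ} (W : Finset ℕ) {i : ℕ} (hi : i < b) (r : Fin (seq i W)) :
    Fin (natPair b (strLen W)) :=
  ⟨natPair i r, natPair_lt_natPair_left hi (r.2.le.trans (seq_le i W))⟩

lemma strMatrix_blockDiagonal_pow {b : ℕ} (W X : Finset ℕ) {i : ℕ} (hi : i < b) (j : ℕ)
    (r c : Fin (seq i W)) :
    (strMatrix (natPair b (strLen W)) (blockDiagonal b W X) ^ j)
        (blockIndex W hi r) (blockIndex W hi c) =
      (strMatrix (seq i W) (row i X) ^ j) r c := by
  refine pow_apply_of_block (fun r c h => ?_) (fun r c => ?_) (fun r x hx => ?_) j r c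
  · simp only [blockIndex, Fin.mk.injEq, natPair_inj, true_and] at h
    exact Fin.ext h
  · unfold strMatrix
    congr 1
    simp only [blockIndex, mem_blockDiagonal, natPair_inj, mem_row, eq_iff_iff]
    constructor
    · rintro ⟨i', -, r', -, c', -, h, ⟨rfl, rfl⟩, -, rfl⟩
      exact h
    · exact fun h => ⟨i, hi, r, r.2, c, c.2, h, ⟨rfl, rfl⟩, rfl, rfl⟩
  · refine if_neg fun h => hx ?_
    simp only [blockIndex, mem_blockDiagonal, natPair_inj] at h
    obtain ⟨i', -, r', -, c', hc', -, ⟨rfl, -⟩, hx⟩ := h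
    exact ⟨⟨c', hc'⟩, Fin.ext hx.symm⟩

/-! ### The formula defines the aggregate function -/

lemma mem_powSeqStar {b : ℕ} {W₁ W₂ X : Finset ℕ} {z : ℕ} :
    z ∈ powSeqStar b W₁ W₂ X ↔ ∃ i < b, ∃ j ≤ seq i W₂, ∃ r c : Fin (seq i W₁),
      (strMatrix (seq i W₁) (row i X) ^ j) r c = 1 ∧
        z = natPair i (natPair j (natPair r c)) := by
  simp only [powSeqStar, Finset.mem_biUnion, Finset.mem_range, Finset.mem_image, mem_powSeq]
  constructor
  · rintro ⟨i, hi, -, ⟨j, hj, r, c, h, rfl⟩, rfl⟩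
    exact ⟨i, hi, j, hj, r, c, h, rfl⟩
  · rintro ⟨i, hi, j, hj, r, c, h, rfl⟩
    exact ⟨i, hi, _, ⟨j, hj, r, c, h, rfl⟩, rfl⟩

lemma ltSeq_standardModel {i r : ℕ} {W : Finset ℕ} :
    standardModel.LtSeq i r W ↔ r < seq i W :=
  (and_congr standardModel_lt Iff.rfl).trans lt_seq_iff.symm

lemma leSeq_standardModel {i j : ℕ} {W : Finset ℕ} :
    standardModel.LeSeq i j W ↔ j ≤ seq i W :=
  (and_congr Iff.rfl (forall_congr' fun _ => imp_congr_left standardModel_lt)).trans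
    le_seq_iff.symm

lemma blockDiagonalBit_standardModel {z b : ℕ} {W₁ X : Finset ℕ} :
    standardModel.BlockDiagonalBit z b W₁ X ↔ z ∈ blockDiagonal b W₁ X := by
  rw [mem_blockDiagonal]
  constructor
  · rintro ⟨i, hi, r, -, c, -, ⟨hr, hc⟩, h, e⟩
    exact ⟨i, standardModel_lt.1 hi, r, ltSeq_standardModel.1 hr, c, ltSeq_standardModel.1 hc, h, e⟩
  · rintro ⟨i, hi, r, hr, c, hc, h, e⟩
    exact ⟨i, standardModel_lt.2 hi, r, (ltSeq_standardModel.2 hr).1, c,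
      (ltSeq_standardModel.2 hc).1, ⟨ltSeq_standardModel.2 hr, ltSeq_standardModel.2 hc⟩, h, e⟩

lemma blockEntryBit_standardModel {z b : ℕ} {W₁ W₂ X : Finset ℕ} :
    standardModel.BlockEntryBit z b
        (powSeq (natPair b (strLen W₁)) (strLen W₂) (blockDiagonal b W₁ X)) W₁ W₂ ↔
      z ∈ powSeqStar b W₁ W₂ X := by
  have key {i j : ℕ} (hi : i < b) (hj : j ≤ seq i W₂) (r c : Fin (seq i W₁)) :
      natPair j (natPair (natPair i r) (natPair i c)) ∈
          powSeq (natPair b (strLen W₁)) (strLen W₂) (blockDiagonal b W₁ X) ↔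
        (strMatrix (seq i W₁) (row i X) ^ j) r c = 1 := by
    rw [← strMatrix_blockDiagonal_pow W₁ X hi j r c,
      ← natPair_mem_powSeq (hj.trans (seq_le i W₂))]
    rfl
  rw [mem_powSeqStar]
  constructor
  · rintro ⟨i, hi, j, -, r, -, c, -, ⟨hj, hr, hc⟩, h, e⟩
    exact ⟨i, standardModel_lt.1 hi, j, leSeq_standardModel.1 hj, ⟨r, ltSeq_standardModel.1 hr⟩,
      ⟨c, ltSeq_standardModel.1 hc⟩,
      (key (standardModel_lt.1 hi) (leSeq_standardModel.1 hj) _ _).1 h, e⟩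
  · rintro ⟨i, hi, j, hj, r, c, h, e⟩
    have hj' := leSeq_standardModel.2 hj
    have hr := ltSeq_standardModel.2 r.2
    have hc := ltSeq_standardModel.2 c.2
    exact ⟨i, standardModel_lt.2 hi, j, hj'.1, r.val, hr.1, c.val, hc.1, ⟨hj', hr, hc⟩,
      (key hi hj r c).2 h, e⟩

lemma eq_iff_strLen_le_and {X Y : Finset ℕ} {t : ℕ} (hX : strLen X ≤ t) :
    Y = X ↔ strLen Y ≤ t ∧ ∀ z < t, z ∈ Y ↔ z ∈ X := by
  refine ⟨fun h => ⟨h ▸ hX, fun _ _ => h ▸ Iff.rfl⟩, fun ⟨hY, h⟩ => Finset.ext fun z => ?_⟩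
  exact ⟨fun hz => (h z (strLen_le_iff.1 hY z hz)).1 hz,
    fun hz => (h z (strLen_le_iff.1 hX z hz)).2 hz⟩

lemma isBlockDiagonal_standardModel {b : ℕ} {W₁ X X' : Finset ℕ} :
    standardModel.IsBlockDiagonal b W₁ X X' ↔ X' = blockDiagonal b W₁ X := by
  have hlen : strLen (blockDiagonal b W₁ X) ≤
      natPair (natPair b (strLen W₁)) (natPair b (strLen W₁)) := by
    refine strLen_le_iff.2 fun z hz => ?_
    obtain ⟨i, hi, r, hr, c, hc, -, rfl⟩ := mem_blockDiagonal.1 hz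
    exact natPair_lt_natPair_left (blockIndex W₁ hi ⟨r, hr⟩).2 (blockIndex W₁ hi ⟨c, hc⟩).2.le
  rw [eq_iff_strLen_le_and hlen]
  exact and_congr Iff.rfl (forall_congr' fun _ => imp_congr standardModel_lt
    (iff_congr Iff.rfl blockDiagonalBit_standardModel))

lemma isBlockEntries_standardModel {b : ℕ} {Y W₁ W₂ X : Finset ℕ} :
    standardModel.IsBlockEntries b Y
        (powSeq (natPair b (strLen W₁)) (strLen W₂) (blockDiagonal b W₁ X)) W₁ W₂ ↔
      Y = powSeqStar b W₁ W₂ X := by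
  have hlen : strLen (powSeqStar b W₁ W₂ X) ≤
      natPair b (natPair (strLen W₂) (natPair (strLen W₁) (strLen W₁))) := by
    refine strLen_le_iff.2 fun z hz => ?_
    obtain ⟨i, hi, j, hj, r, c, -, rfl⟩ := mem_powSeqStar.1 hz
    exact natPair_lt_natPair_left hi (natPair_le_natPair (hj.trans (seq_le i W₂))
      (natPair_le_natPair (r.2.le.trans (seq_le i W₁)) (c.2.le.trans (seq_le i W₁))))
  rw [eq_iff_strLen_le_and hlen]
  exact and_congr Iff.rfl (forall_congr' fun _ => imp_congr standardModel_lt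
    (iff_congr Iff.rfl blockEntryBit_standardModel))

theorem starFormula_standardModel {b : ℕ} {Y W₁ W₂ X : Finset ℕ} :
    starFormula.Holds standardModel ![b] ![Y, W₁, W₂, X] ↔ Y = powSeqStar b W₁ W₂ X := by
  refine (Struct.holds_starFormula (M := standardModel) (fun a : ℕ => le_refl a)
    fun (a : ℕ) (X : Finset ℕ) h => standardModel_lt.2 (lt_strLen h)).trans ?_
  constructor
  · rintro ⟨X', hX', Y', -, Z', -, hp, hY⟩
    obtain rfl := isBlockDiagonal_standardModel.1 hX'
    obtain rfl := (isPowSeq_standardModel.1 hp).eq_powSeq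
    exact isBlockEntries_standardModel.1 hY
  · intro hY
    obtain ⟨hY', Z', hZ', hp⟩ :=
      exists_natIsPowSeq (natPair b (strLen W₁)) (strLen W₂) (blockDiagonal b W₁ X)
    exact ⟨_, isBlockDiagonal_standardModel.2 rfl, _, hY', Z', hZ', isPowSeq_standardModel.2 hp,
      isBlockEntries_standardModel.2 hY⟩

end TwoSorted

/-- The aggregate matrix powering function `PowSeq₂*(b, W₁, W₂, X)` is `Σ₁ᴮ`-definable in `V⊕L`. -/
theorem mainTheorem11 :
    TwoSorted.SigmaB1Definable.{u, v} TwoSorted.VParityL (a := 1) (c := 3)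
      (fun x W => TwoSorted.powSeqStar (x 0) (W 0) (W 1) (W 2)) := by
  refine ⟨TwoSorted.starFormula, TwoSorted.isSigmaB1_starFormula, fun M hM e E => ?_,
    fun x W Y => ?_⟩
  · rw [TwoSorted.Fml.holds_exUniqueStr]
    obtain ⟨b, rfl⟩ : ∃ b, e = ![b] := ⟨e 0, by funext i; fin_cases i; rfl⟩
    obtain ⟨W₁, W₂, X, rfl⟩ : ∃ W₁ W₂ X, E = ![W₁, W₂, X] :=
      ⟨E 0, E 1, E 2, by funext i; fin_cases i <;> rfl⟩
    exact TwoSorted.Struct.existsUnique_starFormula hM _ _ _ _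
  · obtain ⟨b, rfl⟩ : ∃ b, x = ![b] := ⟨x 0, by funext i; fin_cases i; rfl⟩
    obtain ⟨W₁, W₂, X, rfl⟩ : ∃ W₁ W₂ X, W = ![W₁, W₂, X] :=
      ⟨W 0, W 1, W 2, by funext i; fin_cases i <;> rfl⟩
    exact TwoSorted.starFormula_standardModel.symm
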